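/- Let $1<q<p\le\infty$. There is a constant $c_1>0$ depending only on $p,q$, and for every $C>0$ there is a constant $c_2>0$ depending only on $p,q,C$, such that the following holds. Let $X$ be a real random variable with $\mathbb E|X|^q<\infty$ such that $|X|$ has a density that is continuous on $(0,\infty)$. For $s\ge 0$ let $$M_{X,p}(s)=\frac{p}{p-1}\int_0^s\Big(\int_{|X|\le 1/t}t^{p-1}|X|^p\,d\mathbb P+\int_{|X|\ge 1/t}|X|\,d\mathbb P\Big)dt\quad(p<\infty),\qquad M_{X,\infty}(s)=\int_0^s\int_{|X|\ge 1/t}|X|\,d\mathbb P\,dt .$$ Assume that $\lim_{t\to0^+}M_{X,p}''(t)/t^{q-2}$ exists in $\overline{\mathbb R}=[-\infty,\infty]$ and that $$\int_0^s\frac{M_{X,p}(t)}{t^{q}}\,\frac{dt}{t}\le C\,\frac{M_{X,p}(s)}{s^q}\qquad\text{for all }0<s\le M_{X,p}^{-1}(1).$$ Let $n\in\mathbb N$, let $X_1,\dots,X_n$ be copies of $X$ and let $\xi_1,\dots,\xi_n$ be copies of a random variable $\xi$ with density $f_\xi(x)=q(q-1)x^{-q-1}\mathbf 1_{[(q-1)^{1/q},\infty)}(x)$,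 such that $\xi_1,\dots,\xi_n,X_1,\dots,X_n$ are independent. Then for every matrix $(a_{ij})_{i,j=1}^n\in\mathbb R^{n\times n}$ the random variable $\|(a_{ij}\xi_iX_j)_{i,j=1}^n\|_p$ is integrable and $$c_1\Big\|\big(\|(a_{ij})_{j=1}^n\|_{M_{X,p}}\big)_{i=1}^n\Big\|_q\le \mathbb E_\xi\mathbb E_X\big\|(a_{ij}\xi_iX_j)_{i,j=1}^n\big\|_p\le c_2\Big\|\big(\|(a_{ij})_{j=1}^n\|_{M_{X,p}}\big)_{i=1}^n\Big\|_q .$$ Here $\|\cdot\|_r$ is the $\ell_r$-norm (the maximum norm if $r=\infty$), and $\|x\|_M=\inf\{t>0:\sum_{j=1}^nM(|x_j|/t)\le1\}$ for $x\in\mathbb R^n$. -/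

import Mathlib

open MeasureTheory ProbabilityTheory Filter Topology
open scoped ENNReal

noncomputable section

/-- The `ℓ_p`-norm of a finite family of reals, `0 < p ≤ ∞`: it is `(∑ |x k| ^ p) ^ (1 / p)` for
`p < ∞` and the maximum of the `|x k|` for `p = ∞`. -/
def ellNorm {ι : Type*} [Fintype ι] (p : ℝ≥0∞) (x : ι → ℝ) : ℝ :=
  ‖(WithLp.toLp p x : PiLp p (fun _ : ι => ℝ))‖

/-- The Luxemburg norm `inf {t > 0 : ∑ M (|x i| / t) ≤ 1}`. -/
def luxemburgNorm {n : ℕ} (M : ℝ → ℝ) (x : Fin n → ℝ) : ℝ :=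
  sInf {t : ℝ | 0 < t ∧ ∑ i, M (|x i| / t) ≤ 1}

/-- The function `M_{X,p}` on `[0, ∞)` attached to a random variable `X` and `1 < p ≤ ∞`
(values at negative arguments are irrelevant). -/
def orliczFun {Ω : Type*} [MeasurableSpace Ω] (P : Measure Ω) (X : Ω → ℝ) (p : ℝ≥0∞) (s : ℝ) : ℝ :=
  if p = ∞ then
    ∫ t in (0 : ℝ)..s, ∫ ω in {ω | 1 / t ≤ |X ω|}, |X ω| ∂P
  else
    p.toReal / (p.toReal - 1) *
      ∫ t in (0 : ℝ)..s,
        ((∫ ω in {ω | |X ω| ≤ 1 / t}, t ^ (p.toReal - 1) * |X ω| ^ p.toReal ∂P) +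
          ∫ ω in {ω | 1 / t ≤ |X ω|}, |X ω| ∂P)

/-- The density `q (q - 1) x ^ (-q - 1)` on `[(q - 1) ^ (1 / q), ∞)`. -/
def paretoTypeDensity (q : ℝ) : ℝ → ℝ :=
  (Set.Ici ((q - 1) ^ (1 / q))).indicator fun x => q * (q - 1) * x ^ (-q - 1)

/-- The law on `ℝ` with the above density. -/
def paretoTypeLaw (q : ℝ) : Measure ℝ :=
  volume.withDensity fun x => ENNReal.ofReal (paretoTypeDensity q x)

/-- `|X|` has a density on `(0, ∞)` that is continuous there. -/
def AbsHasContinuousDensity {Ω : Type*} [MeasurableSpace Ω] (P : Measure Ω) (X : Ω → ℝ) : Prop :=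
  ∃ f : ℝ → ℝ, ContinuousOn f (Set.Ioi 0) ∧ (∀ x, 0 < x → 0 ≤ f x) ∧
    HasLaw (fun ω => |X ω|)
      ((volume.restrict (Set.Ioi 0)).withDensity fun x => ENNReal.ofReal (f x)) P

/-- The limit of `M''(t) / t ^ (q - 2)` as `t → 0+` exists in the extended reals. -/
def LimitCondition (M : ℝ → ℝ) (q : ℝ) : Prop :=
  ∃ L : EReal, Tendsto (fun t : ℝ => ((deriv (deriv M) t / t ^ (q - 2) : ℝ) : EReal))
    (𝓝[>] 0) (𝓝 L)

/-- `∫₀ˢ M(t) / t ^ q dt / t ≤ C * M(s) / s ^ q` for all `0 < s ≤ M⁻¹(1)`. The range of `s` is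
written as `0 < s`, `M s ≤ 1`, which is the same for a convex function `M ≥ 0` on `[0, ∞)` with
`M 0 = 0` and `M ≢ 0`. The integral is taken in `[0, ∞]`. -/
def IntegralCondition (M : ℝ → ℝ) (q C : ℝ) : Prop :=
  ∀ s : ℝ, 0 < s → M s ≤ 1 →
    ∫⁻ t in Set.Ioc 0 s, ENNReal.ofReal (M t / t ^ q / t) ≤ ENNReal.ofReal (C * (M s / s ^ q))

end

/-! ### Deterministic estimates for the `ℓ_p`-norm. -/

section EllNorm

variable {ι κ : Type*} [Fintype ι] [Fintype κ]

/-! Write `b i` for the `ℓ_p`-norm of the `i`-th row `(a i j * X j)_j`. The matrix norm is the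
`ℓ_p`-norm of `(b i * ξ i)_i`, so the problem splits into an average over `ξ` with `X` frozen and an
average over `X` of what remains.

The average over `ξ` turns `ℓ_p` into `ℓ_q`. The Pareto tail gives `𝔼 |s ξ| 1{|s ξ| ≥ 1}` of order
`s ^ q` for small `s`, and for finite `p > q` the truncated moment `𝔼 |s ξ| ^ p 1{|s ξ| < 1}` is at
most a constant times `s ^ q`. Hence the mean is comparable to `‖b‖_q`
(`lintegral_pareto_ellNorm_le`, `le_lintegral_pareto_ellNorm`).

It remains to estimate `𝔼 ‖b‖_q`. The triangle inequality for integrals gives `‖𝔼 b‖_q ≤ 𝔼 ‖b‖_q`,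
and Jensen gives `𝔼 ‖b‖_q ≤ (∑ 𝔼 b_i ^ q) ^ (1 / q)`. So each row needs a lower bound for its first
moment and an upper bound for its `q`-th moment, both in terms of the Luxemburg norm
(`le_lintegral_row`, `lintegral_row_rpow_le`).

The link with `M_{X,p}` is Fubini: `M(s) = 𝔼 φ(s|X|)`, where `φ` is, up to constants, the sum of `u
^ p` on small `u` and `u` on large `u`. Both row bounds come from truncating the entries. For
independent entries, if the sum of the truncated means is bounded below, then so is the mean
`ℓ_p`-norm (`le_lintegral_ellNorm`); this needs only `M`. For the `q`-th moment the large entries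
contribute `𝔼 |s X| ^ q 1{|s X| ≥ 2}`, which `M` alone does not control; the integral condition on
`M` is what bounds it by a multiple of `M(s)` (`lintegral_tail_le`). -/

theorem toReal_pos_of_one_le {p : ℝ≥0∞} (hp : 1 ≤ p) (hp' : p ≠ ∞) : 0 < p.toReal :=
  ENNReal.toReal_pos (by rintro rfl; simp at hp) hp'

theorem ellNorm_eq_sum {p : ℝ≥0∞} (hp : 1 ≤ p) (hp' : p ≠ ∞) (x : ι → ℝ) :
    ellNorm p x = (∑ i, |x i| ^ p.toReal) ^ (1 / p.toReal) := by
  simp [ellNorm, PiLp.norm_eq_sum (toReal_pos_of_one_le hp hp')]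

theorem ellNorm_rpow {p : ℝ≥0∞} (hp : 1 ≤ p) (hp' : p ≠ ∞) (x : ι → ℝ) :
    ellNorm p x ^ p.toReal = ∑ i, |x i| ^ p.toReal := by
  rw [ellNorm_eq_sum hp hp', one_div, Real.rpow_inv_rpow _ (toReal_pos_of_one_le hp hp').ne']
  exact Finset.sum_nonneg fun i _ => by positivity

theorem ellNorm_nonneg {p : ℝ≥0∞} (hp : 1 ≤ p) (x : ι → ℝ) : 0 ≤ ellNorm p x := by
  have : Fact (1 ≤ p) := ⟨hp⟩
  exact norm_nonneg _

theorem abs_le_ellNorm {p : ℝ≥0∞} (hp : 1 ≤ p) (x : ι → ℝ) (i : ι) : |x i| ≤ ellNorm p x := by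
  have : Fact (1 ≤ p) := ⟨hp⟩
  exact PiLp.norm_apply_le (WithLp.toLp p x : PiLp p (fun _ : ι => ℝ)) i

theorem ellNorm_smul {p : ℝ≥0∞} (hp : 1 ≤ p) (c : ℝ) (x : ι → ℝ) :
    ellNorm p (fun i => c * x i) = |c| * ellNorm p x := by
  have : Fact (1 ≤ p) := ⟨hp⟩
  exact norm_smul c (WithLp.toLp p x : PiLp p (fun _ : ι => ℝ))

theorem ellNorm_top_le {x : ι → ℝ} {c : ℝ} (hc : 0 ≤ c) (h : ∀ i, |x i| ≤ c) :
    ellNorm ∞ x ≤ c := by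
  rw [ellNorm, PiLp.norm_eq_ciSup]
  exact Real.iSup_le h hc

theorem ellNorm_mono {p : ℝ≥0∞} (hp : 1 ≤ p) {x y : ι → ℝ} (h : ∀ i, |x i| ≤ |y i|) :
    ellNorm p x ≤ ellNorm p y := by
  by_cases hp' : p = ∞
  · subst hp'
    exact ellNorm_top_le (ellNorm_nonneg hp y) fun i => (h i).trans (abs_le_ellNorm hp y i)
  · rw [ellNorm_eq_sum hp hp', ellNorm_eq_sum hp hp']
    have hP := toReal_pos_of_one_le hp hp'
    exact Real.rpow_le_rpow (Finset.sum_nonneg fun i _ => by positivity)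
      (Finset.sum_le_sum fun i _ => Real.rpow_le_rpow (abs_nonneg _) (h i) hP.le) (by positivity)

theorem measurable_ellNorm {p : ℝ≥0∞} (hp : 1 ≤ p) :
    Measurable (ellNorm p : (ι → ℝ) → ℝ) := by
  have : Fact (1 ≤ p) := ⟨hp⟩
  unfold ellNorm
  fun_prop

theorem ellNorm_prod {p : ℝ≥0∞} (hp : 1 ≤ p) (x : ι × κ → ℝ) :
    ellNorm p x = ellNorm p (fun i => ellNorm p fun j => x (i, j)) := by
  have h0 : ∀ i, 0 ≤ ellNorm p fun j => x (i, j) := fun i => ellNorm_nonneg hp _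
  by_cases hp' : p = ∞
  · subst hp'
    apply le_antisymm
    · refine ellNorm_top_le (ellNorm_nonneg hp _) fun k => ?_
      refine (abs_le_ellNorm hp (fun j => x (k.1, j)) k.2).trans ?_
      exact (le_abs_self _).trans
        (abs_le_ellNorm hp (fun i => ellNorm ∞ fun j => x (i, j)) k.1)
    · refine ellNorm_top_le (ellNorm_nonneg hp _) fun i => ?_
      rw [abs_of_nonneg (h0 i)]
      exact ellNorm_top_le (ellNorm_nonneg hp _) fun j => abs_le_ellNorm hp x (i, j)
  · rw [ellNorm_eq_sum hp hp', ellNorm_eq_sum hp hp', Fintype.sum_prod_type]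
    congr 1
    refine Finset.sum_congr rfl fun i _ => ?_
    rw [abs_of_nonneg (h0 i), ellNorm_rpow hp hp']

theorem ellNorm_mul_mul {p : ℝ≥0∞} (hp : 1 ≤ p) (a : ι → κ → ℝ) (u : ι → ℝ) (v : κ → ℝ) :
    ellNorm p (fun k : ι × κ => a k.1 k.2 * u k.1 * v k.2) =
      ellNorm p fun i => ellNorm p (fun j => a i j * v j) * u i := by
  rw [ellNorm_prod hp]
  apply le_antisymm <;>
  · refine ellNorm_mono hp fun i => le_of_eq ?_
    have : (fun j => a i j * u i * v j) = fun j => u i * (a i j * v j) := by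
      ext j; ring
    simp only [this, ellNorm_smul hp, abs_mul, abs_abs]
    ring

/-- The power `u ^ p` that a small entry contributes to `‖·‖_p ^ p`, read as `0` when `p = ∞`. -/
noncomputable def powCost (p : ℝ≥0∞) (u : ℝ) : ℝ := if p = ∞ then 0 else u ^ p.toReal

theorem powCost_nonneg (p : ℝ≥0∞) {u : ℝ} (hu : 0 ≤ u) : 0 ≤ powCost p u := by
  unfold powCost; split_ifs <;> positivity

theorem measurable_powCost (p : ℝ≥0∞) : Measurable (powCost p) := by
  unfold powCost
  split_ifs
  · exact measurable_const
  · exact measurable_id.pow_const _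

theorem rpow_le_one_add {z s : ℝ} (hz : 0 ≤ z) (hs : s ≤ 1) (hs0 : 0 ≤ s) : z ^ s ≤ 1 + z := by
  rcases le_total z 1 with h | h
  · exact (Real.rpow_le_one hz h hs0).trans (by linarith)
  · calc z ^ s ≤ z ^ (1 : ℝ) := Real.rpow_le_rpow_of_exponent_le h hs
      _ ≤ 1 + z := by simp

theorem rpow_finset_sum_le {ι : Type*} (s : Finset ι) {r : ℝ} (hr0 : 0 < r) (hr : r ≤ 1)
    {f : ι → ℝ} (hf : ∀ i, 0 ≤ f i) : (∑ i ∈ s, f i) ^ r ≤ ∑ i ∈ s, f i ^ r := by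
  classical
  induction s using Finset.induction_on with
  | empty => simp [Real.zero_rpow hr0.ne']
  | insert a s ha ih =>
    rw [Finset.sum_insert ha, Finset.sum_insert ha]
    exact (Real.rpow_add_le_add_rpow (hf a) (Finset.sum_nonneg fun i _ => hf i) hr0.le hr).trans
      (by gcongr)

/-- Raising `‖x‖_p ^ p` to the power `r / p ≤ 1` is subadditive. The entries below `θ` give `z ^ (r
/ p) ≤ 1 + z`, whose `1` is absorbed by `θ ^ r`; the others give a sum of `r`-th powers. For `p = ∞`
the maximum is either below `θ` or one of the large entries. The cases used are `r = 1` for `ξ` and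
`r = q` for the rows. -/
theorem ellNorm_rpow_le {p : ℝ≥0∞} (hp : 1 ≤ p) {r θ : ℝ} (hr : 1 ≤ r)
    (hrp : ENNReal.ofReal r ≤ p) (hθ : 1 ≤ θ) (x : ι → ℝ) :
    ellNorm p x ^ r ≤ θ ^ r + ∑ i, ((if |x i| < θ then powCost p |x i| else 0) +
      (if |x i| < θ then 0 else |x i| ^ r)) := by
  have hr0 : 0 < r := by linarith
  have hθ1 : 1 ≤ θ ^ r := Real.one_le_rpow hθ hr0.le
  by_cases hp' : p = ∞
  · subst hp'
    set R := ∑ i, ((if |x i| < θ then powCost ∞ |x i| else 0) +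
      (if |x i| < θ then 0 else |x i| ^ r)) with hR
    have hterm : ∀ i, 0 ≤ (if |x i| < θ then powCost ∞ |x i| else 0) +
        (if |x i| < θ then 0 else |x i| ^ r) := by
      intro i; simp only [powCost]; split_ifs <;> positivity
    have hR0 : 0 ≤ R := Finset.sum_nonneg fun i _ => hterm i
    have key : ellNorm ∞ x ≤ (θ ^ r + R) ^ (1 / r) := by
      refine ellNorm_top_le (by positivity) fun i => ?_
      rw [one_div, Real.le_rpow_inv_iff_of_pos (abs_nonneg _) (by positivity) hr0]
      by_cases h : |x i| < θ
      · have := Real.rpow_le_rpow (abs_nonneg _) h.le hr0.le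
        linarith
      · have := Finset.single_le_sum (fun i _ => hterm i) (Finset.mem_univ i)
        simp only [h, if_false, zero_add] at this
        linarith
    calc _ ≤ ((θ ^ r + R) ^ (1 / r)) ^ r :=
          Real.rpow_le_rpow (ellNorm_nonneg hp x) key hr0.le
      _ = _ := by rw [one_div, Real.rpow_inv_rpow (by positivity) hr0.ne']
  · have hP := toReal_pos_of_one_le hp hp'
    have hrP : r ≤ p.toReal := (ENNReal.ofReal_le_iff_le_toReal hp').1 hrp
    have hs1 : r / p.toReal ≤ 1 := (div_le_one hP).2 hrP
    have hs0 : 0 < r / p.toReal := by positivity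
    have e1 : ellNorm p x ^ r = (∑ i, |x i| ^ p.toReal) ^ (r / p.toReal) := by
      rw [ellNorm_eq_sum hp hp', ← Real.rpow_mul (Finset.sum_nonneg fun i _ => by positivity)]
      congr 1; ring
    have e2 : ∑ i, |x i| ^ p.toReal = ∑ i, (if |x i| < θ then |x i| ^ p.toReal else 0) +
        ∑ i, (if |x i| < θ then 0 else |x i| ^ p.toReal) := by
      rw [← Finset.sum_add_distrib]
      refine Finset.sum_congr rfl fun i _ => ?_
      split_ifs <;> simp
    have n1 : 0 ≤ ∑ i, (if |x i| < θ then |x i| ^ p.toReal else 0) :=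
      Finset.sum_nonneg fun i _ => by split_ifs <;> positivity
    have n2 : ∀ i, 0 ≤ (if |x i| < θ then 0 else |x i| ^ p.toReal) :=
      fun i => by split_ifs <;> positivity
    rw [e1, e2, Finset.sum_add_distrib]
    refine (Real.rpow_add_le_add_rpow n1 (Finset.sum_nonneg fun i _ => n2 i) hs0.le hs1).trans ?_
    have h1 := rpow_le_one_add n1 hs1 hs0.le
    have h2 := rpow_finset_sum_le Finset.univ hs0 hs1 n2
    have h3 : ∀ i, (if |x i| < θ then 0 else |x i| ^ p.toReal) ^ (r / p.toReal) =
        if |x i| < θ then 0 else |x i| ^ r := by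
      intro i
      split_ifs
      · exact Real.zero_rpow hs0.ne'
      · rw [← Real.rpow_mul (abs_nonneg _)]
        congr 1; field_simp
    simp only [h3] at h2
    simp only [powCost, hp', if_false]
    linarith

/-- Since `1 - exp (-Z) ≤ min Z 1 ≤ Z ^ (1 / p)`. The left side is a Laplace transform, which
factorises under independence, unlike the norm itself. -/
theorem one_sub_exp_le_ellNorm {p : ℝ≥0∞} (hp : 1 ≤ p) (hp' : p ≠ ∞) (x : ι → ℝ) :
    1 - Real.exp (-∑ i, if |x i| ≤ 1 then |x i| ^ p.toReal else 0) ≤ ellNorm p x := by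
  have hP := toReal_pos_of_one_le hp hp'
  have hP1 : 1 ≤ p.toReal := (ENNReal.toReal_mono hp' hp).trans' (by simp)
  set Z := ∑ i, if |x i| ≤ 1 then |x i| ^ p.toReal else 0 with hZ
  have hZ0 : 0 ≤ Z := Finset.sum_nonneg fun i _ => by split_ifs <;> positivity
  have hZx : Z ^ (1 / p.toReal) ≤ ellNorm p x := by
    rw [ellNorm_eq_sum hp hp']
    refine Real.rpow_le_rpow hZ0 (Finset.sum_le_sum fun i _ => ?_) (by positivity)
    split_ifs
    · exact le_rfl
    · positivity
  refine le_trans ?_ hZx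
  rcases le_total Z 1 with h | h
  · have h1 : Z ^ (1 : ℝ) ≤ Z ^ (1 / p.toReal) :=
      Real.rpow_le_rpow_of_exponent_ge_of_imp hZ0 h ((div_le_one hP).2 hP1) (by simp)
    have := Real.add_one_le_exp (-Z)
    simp only [Real.rpow_one] at h1
    linarith
  · have := Real.one_le_rpow h (by positivity : 0 ≤ 1 / p.toReal)
    have := Real.exp_pos (-Z)
    linarith

end EllNorm

/-! ### Lower bounds for maxima and sums of independent variables. -/

section Independence

variable {Ω ι : Type*} [MeasurableSpace Ω] [Fintype ι] {P : Measure Ω}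

theorem lintegral_mul_compl_of_iIndepFun [DecidableEq ι] {Y : ι → Ω → ℝ≥0∞}
    (hY : ∀ i, Measurable (Y i)) (hind : iIndepFun Y P) (i : ι) {φ : ℝ≥0∞ → ℝ≥0∞}
    (hφ : Measurable φ) {ψ : (({i}ᶜ : Finset ι) → ℝ≥0∞) → ℝ≥0∞} (hψ : Measurable ψ) :
    ∫⁻ ω, φ (Y i ω) * ψ (fun k => Y k ω) ∂P =
      (∫⁻ ω, φ (Y i ω) ∂P) * ∫⁻ ω, ψ (fun k => Y k ω) ∂P := by
  have h1 := hind.indepFun_finset {i} {i}ᶜ disjoint_compl_right hY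
  have hφi : Measurable fun y : ({i} : Finset ι) → ℝ≥0∞ => φ (y ⟨i, by simp⟩) :=
    hφ.comp (measurable_pi_apply (⟨i, by simp⟩ : ({i} : Finset ι)))
  have h2 := h1.comp hφi hψ
  exact lintegral_mul_eq_lintegral_mul_lintegral_of_indepFun''
    (hφ.comp (hY i)).aemeasurable
    (hψ.comp (measurable_pi_lambda _ fun k => hY k)).aemeasurable h2

/-- Let `A` be the event that no `Y i` exceeds `1`. If `P A ≤ 1/2`, the maximum exceeds `1` with
probability at least `1/2`. Otherwise consider the disjoint events that exactly `Y i` exceeds `1`: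
the condition on the other variables is independent of `Y i` and has probability at least `P A ≥
1/2`. -/
theorem min_half_le_lintegral_iSup [IsProbabilityMeasure P] {Y : ι → Ω → ℝ≥0∞} (hY : ∀ i, Measurable (Y i))
    (hind : iIndepFun Y P) :
    min (1 / 2) (1 / 2 * ∑ i, ∫⁻ ω, (if 1 < Y i ω then Y i ω else 0) ∂P) ≤
      ∫⁻ ω, ⨆ i, Y i ω ∂P := by
  classical
  set A : Set Ω := {ω | ∀ i, Y i ω ≤ 1} with hA
  have hAm : MeasurableSet A := by
    rw [hA, Set.ofPred_forall]
    exact MeasurableSet.iInter fun i => measurableSet_le (hY i) measurable_const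
  rcases le_total (1 / 2) (P A) with hPA | hPA
  · refine (min_le_right _ _).trans ?_
    let ψ : (i : ι) → (({i}ᶜ : Finset ι) → ℝ≥0∞) → ℝ≥0∞ := fun i y =>
      if ∀ k, y k ≤ 1 then 1 else 0
    have hψ : ∀ i, Measurable (ψ i) := fun i => by
      refine Measurable.ite ?_ measurable_const measurable_const
      rw [Set.ofPred_forall]
      exact MeasurableSet.iInter fun k =>
        measurableSet_le (measurable_pi_apply _) measurable_const
    let φ : ℝ≥0∞ → ℝ≥0∞ := fun y => if 1 < y then y else 0
    have hφ : Measurable φ :=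
      Measurable.ite (measurableSet_lt measurable_const measurable_id) measurable_id
        measurable_const
    let B : ι → Ω → ℝ≥0∞ := fun i ω => ψ i fun k => Y k ω
    have hBm : ∀ i, Measurable (B i) := fun i =>
      (hψ i).comp (measurable_pi_lambda _ fun k => hY k)
    have hGm : ∀ i, Measurable fun ω => if 1 < Y i ω then Y i ω else 0 := fun i =>
      Measurable.ite (measurableSet_lt measurable_const (hY i)) (hY i) measurable_const
    have hfac : ∀ i, ∫⁻ ω, (if 1 < Y i ω then Y i ω else 0) * B i ω ∂P =
        (∫⁻ ω, (if 1 < Y i ω then Y i ω else 0) ∂P) * ∫⁻ ω, B i ω ∂P := fun i =>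
      lintegral_mul_compl_of_iIndepFun hY hind i hφ (hψ i)
    have hBA : ∀ i, 1 / 2 ≤ ∫⁻ ω, B i ω ∂P := fun i => by
      refine hPA.trans ?_
      rw [← lintegral_indicator_one hAm]
      refine lintegral_mono fun ω => ?_
      by_cases h : ω ∈ A
      · have : ∀ k : ({i}ᶜ : Finset ι), Y k ω ≤ 1 := fun k => h k
        simp only [B, ψ, this, implies_true, if_true]
        simp [h]
      · simp [h]
    -- At most one summand is nonzero, because `B i` forces every other variable to be at most `1`.
    have hpt : ∀ ω, ∑ i, (if 1 < Y i ω then Y i ω else 0) * B i ω ≤ ⨆ i, Y i ω := fun ω => by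
      by_cases h : ∃ i, 1 < Y i ω ∧ ∀ k : ({i}ᶜ : Finset ι), Y k ω ≤ 1
      · obtain ⟨i, hi, hk⟩ := h
        rw [Finset.sum_eq_single i]
        · refine le_trans ?_ (le_iSup (fun i => Y i ω) i)
          simp only [B, ψ, hk, hi, implies_true, if_true, mul_one, le_refl]
        · intro j _ hj
          have := hk ⟨j, by simp [hj]⟩
          simp [not_lt.2 this]
        · simp
      · push Not at h
        rw [Finset.sum_eq_zero]
        · exact zero_le
        · intro i _
          by_cases hi : 1 < Y i ω
          · obtain ⟨k, hk⟩ := h i hi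
            have : ¬ ∀ k : ({i}ᶜ : Finset ι), Y k ω ≤ 1 := fun h => (h k).not_gt hk
            simp only [B, ψ, this, if_false, mul_zero]
          · simp [hi]
    calc 1 / 2 * ∑ i, ∫⁻ ω, (if 1 < Y i ω then Y i ω else 0) ∂P
        = ∑ i, (∫⁻ ω, (if 1 < Y i ω then Y i ω else 0) ∂P) * (1 / 2) := by
          rw [mul_comm, Finset.sum_mul]
      _ ≤ ∑ i, (∫⁻ ω, (if 1 < Y i ω then Y i ω else 0) ∂P) * ∫⁻ ω, B i ω ∂P := by
          gcongr with i _
          exact hBA i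
      _ = ∫⁻ ω, ∑ i, (if 1 < Y i ω then Y i ω else 0) * B i ω ∂P := by
          rw [lintegral_finsetSum (s := Finset.univ)
            (f := fun i ω => (if 1 < Y i ω then Y i ω else 0) * B i ω)
            fun i _ => (hGm i).mul (hBm i)]
          exact Finset.sum_congr rfl fun i _ => (hfac i).symm
      _ ≤ _ := lintegral_mono hpt
  · refine (min_le_left _ _).trans ?_
    have hc : 1 / 2 ≤ P Aᶜ := by
      rw [prob_compl_eq_one_sub hAm]
      refine ENNReal.le_sub_of_add_le_left (measure_ne_top _ _) ?_
      calc P A + 1 / 2 ≤ 1 / 2 + 1 / 2 := by gcongr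
        _ = 1 := by rw [one_div]; exact ENNReal.inv_two_add_inv_two
    refine hc.trans ?_
    rw [← lintegral_indicator_one hAm.compl]
    refine lintegral_mono fun ω => ?_
    by_cases h : ω ∈ A
    · simp [h]
    · have h' := h
      simp only [hA, Set.mem_ofPred_eq, not_forall, not_le] at h'
      obtain ⟨i, hi⟩ := h'
      simp only [Set.mem_compl_iff, h, not_false_iff, Set.indicator_of_mem, Pi.one_apply]
      exact hi.le.trans (le_iSup (fun i => Y i ω) i)

theorem exp_neg_le_chord {z : ℝ} (h0 : 0 ≤ z) (h1 : z ≤ 1) :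
    Real.exp (-z) ≤ 1 - (1 - Real.exp (-1)) * z := by
  have := convexOn_exp.2 (Set.mem_univ 0) (Set.mem_univ (-1)) (sub_nonneg.2 h1) h0 (by ring)
  simp only [smul_eq_mul, mul_zero, zero_add, mul_neg, mul_one, Real.exp_zero] at this
  linarith

/-- By independence `𝔼 exp (-∑ Z i)` is a product. The chord bound on `[0, 1]` followed by `1 - y ≤
exp (-y)` turns each factor into an exponential of the mean. -/
theorem one_sub_exp_le_integral [IsProbabilityMeasure P] {Z : ι → Ω → ℝ} (hZ : ∀ i, Measurable (Z i))
    (h0 : ∀ i ω, 0 ≤ Z i ω) (h1 : ∀ i ω, Z i ω ≤ 1) (hind : iIndepFun Z P) :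
    1 - Real.exp (-((1 - Real.exp (-1)) * ∑ i, ∫ ω, Z i ω ∂P)) ≤
      ∫ ω, (1 - Real.exp (-∑ i, Z i ω)) ∂P := by
  have hint : ∀ i, Integrable (Z i) P := fun i =>
    Integrable.of_bound (hZ i).aestronglyMeasurable 1 (ae_of_all _ fun ω => by
      rw [Real.norm_of_nonneg (h0 i ω)]; exact h1 i ω)
  have hexp : ∀ g : Ω → ℝ, Measurable g → (∀ ω, 0 ≤ g ω) →
      Integrable (fun ω => Real.exp (-g ω)) P := fun g hg h =>
    Integrable.of_bound (by fun_prop) 1 (ae_of_all _ fun ω => by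
      rw [Real.norm_of_nonneg (Real.exp_nonneg _)]
      exact Real.exp_le_one_iff.2 (by linarith [h ω]))
  have hS : Integrable (fun ω => Real.exp (-∑ i, Z i ω)) P :=
    hexp _ (by fun_prop) fun ω => Finset.sum_nonneg fun i _ => h0 i ω
  have hmgf := hind.mgf_sum (t := -1) hZ Finset.univ
  have e1 : mgf (∑ i, Z i) P (-1) = ∫ ω, Real.exp (-∑ i, Z i ω) ∂P := by
    simp [mgf, Finset.sum_apply]
  have hone : ∀ i, mgf (Z i) P (-1) ≤ Real.exp (-((1 - Real.exp (-1)) * ∫ ω, Z i ω ∂P)) := by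
    intro i
    calc mgf (Z i) P (-1) = ∫ ω, Real.exp (-Z i ω) ∂P := by simp [mgf]
      _ ≤ ∫ ω, (1 - (1 - Real.exp (-1)) * Z i ω) ∂P :=
          integral_mono (hexp _ (hZ i) (h0 i)) ((integrable_const _).sub ((hint i).const_mul _))
            fun ω => exp_neg_le_chord (h0 i ω) (h1 i ω)
      _ = 1 - (1 - Real.exp (-1)) * ∫ ω, Z i ω ∂P := by
          rw [integral_sub (integrable_const _) ((hint i).const_mul _), integral_const_mul]
          simp
      _ ≤ _ := by
          have := Real.add_one_le_exp (-((1 - Real.exp (-1)) * ∫ ω, Z i ω ∂P))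
          linarith
  have hprod : ∏ i, mgf (Z i) P (-1) ≤
      Real.exp (-((1 - Real.exp (-1)) * ∑ i, ∫ ω, Z i ω ∂P)) := by
    rw [Finset.mul_sum, ← Finset.sum_neg_distrib, Real.exp_sum]
    exact Finset.prod_le_prod (fun i _ => mgf_nonneg) fun i _ => hone i
  rw [integral_sub (integrable_const _) hS, ← e1, hmgf]
  simp only [integral_const, probReal_univ, smul_eq_mul, mul_one]
  linarith

end Independence

/-! ### Moments of the `ℓ_p`-norm of a random vector via truncated entries. -/

section RandomVectors

variable {Ω ι : Type*} [MeasurableSpace Ω] [Fintype ι] {P : Measure Ω} [IsProbabilityMeasure P]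

theorem lintegral_ellNorm_rpow_le {p : ℝ≥0∞} (hp : 1 ≤ p) {r θ : ℝ} (hr : 1 ≤ r)
    (hrp : ENNReal.ofReal r ≤ p) (hθ : 1 ≤ θ) {Y : ι → Ω → ℝ} (hY : ∀ i, Measurable (Y i)) :
    ∫⁻ ω, ENNReal.ofReal (ellNorm p (fun i => Y i ω) ^ r) ∂P ≤ ENNReal.ofReal (θ ^ r) +
      ∑ i, (∫⁻ ω, ENNReal.ofReal (if |Y i ω| < θ then powCost p |Y i ω| else 0) ∂P +
        ∫⁻ ω, ENNReal.ofReal (if |Y i ω| < θ then 0 else |Y i ω| ^ r) ∂P) := by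
  have hA : ∀ i ω, 0 ≤ if |Y i ω| < θ then powCost p |Y i ω| else 0 := fun i ω => by
    split_ifs
    exacts [powCost_nonneg p (abs_nonneg _), le_rfl]
  have hB : ∀ i ω, 0 ≤ if |Y i ω| < θ then 0 else |Y i ω| ^ r := fun i ω => by
    split_ifs <;> positivity
  have hlt : ∀ i, MeasurableSet {ω | |Y i ω| < θ} := fun i =>
    measurableSet_lt (hY i).abs measurable_const
  have hAm : ∀ i, Measurable fun ω => if |Y i ω| < θ then powCost p |Y i ω| else 0 := fun i =>
    Measurable.ite (hlt i) ((measurable_powCost p).comp (hY i).abs) measurable_const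
  have hBm : ∀ i, Measurable fun ω => if |Y i ω| < θ then 0 else |Y i ω| ^ r := fun i =>
    Measurable.ite (hlt i) measurable_const ((hY i).abs.pow_const r)
  calc ∫⁻ ω, ENNReal.ofReal (ellNorm p (fun i => Y i ω) ^ r) ∂P
      ≤ ∫⁻ ω, (ENNReal.ofReal (θ ^ r) +
        ∑ i, (ENNReal.ofReal (if |Y i ω| < θ then powCost p |Y i ω| else 0) +
          ENNReal.ofReal (if |Y i ω| < θ then 0 else |Y i ω| ^ r))) ∂P := by
        refine lintegral_mono fun ω => ?_
        refine (ENNReal.ofReal_le_ofReal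
          (ellNorm_rpow_le hp hr hrp hθ fun i => Y i ω)).trans (le_of_eq ?_)
        rw [ENNReal.ofReal_add (by positivity)
          (Finset.sum_nonneg fun i _ => add_nonneg (hA i ω) (hB i ω)),
          ENNReal.ofReal_sum_of_nonneg fun i _ => add_nonneg (hA i ω) (hB i ω)]
        simp only [ENNReal.ofReal_add (hA _ ω) (hB _ ω)]
    _ = _ := by
        rw [lintegral_add_left measurable_const, lintegral_const, measure_univ, mul_one,
          lintegral_finsetSum (s := Finset.univ)
            (f := fun i ω => ENNReal.ofReal (if |Y i ω| < θ then powCost p |Y i ω| else 0) +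
              ENNReal.ofReal (if |Y i ω| < θ then 0 else |Y i ω| ^ r))
            fun i _ => (hAm i).ennreal_ofReal.add (hBm i).ennreal_ofReal]
        congr 1
        exact Finset.sum_congr rfl fun i _ => lintegral_add_left (hAm i).ennreal_ofReal _

theorem iSup_ofReal_abs_le {p : ℝ≥0∞} (hp : 1 ≤ p) (y : ι → ℝ) :
    ⨆ i, ENNReal.ofReal |y i| ≤ ENNReal.ofReal (ellNorm p y) :=
  iSup_le fun i => ENNReal.ofReal_le_ofReal (abs_le_ellNorm hp y i)

theorem min_le_lintegral_ellNorm {p : ℝ≥0∞} (hp : 1 ≤ p) {Y : ι → Ω → ℝ}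
    (hY : ∀ i, Measurable (Y i)) (hind : iIndepFun Y P) :
    min (1 / 2) (1 / 2 * ∑ i, ∫⁻ ω, ENNReal.ofReal (if 1 < |Y i ω| then |Y i ω| else 0) ∂P) ≤
      ∫⁻ ω, ENNReal.ofReal (ellNorm p fun i => Y i ω) ∂P := by
  have h := min_half_le_lintegral_iSup (Y := fun i ω => ENNReal.ofReal |Y i ω|)
    (fun i => (hY i).abs.ennreal_ofReal)
    (hind.comp (fun _ y => ENNReal.ofReal |y|) fun _ => by fun_prop)
  have e : ∀ i ω, (if 1 < ENNReal.ofReal |Y i ω| then ENNReal.ofReal |Y i ω| else 0) =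
      ENNReal.ofReal (if 1 < |Y i ω| then |Y i ω| else 0) := fun i ω => by
    by_cases h : 1 < |Y i ω| <;> simp [h]
  simp only [e] at h
  exact h.trans (lintegral_mono fun ω => iSup_ofReal_abs_le hp fun i => Y i ω)

/-- A lower bound for the expected `ℓ_p`-norm in `le_lintegral_ellNorm`. -/
noncomputable def ellLowerConst (K : ℝ) : ℝ :=
  min (min (1 / 2) (1 / (4 * K))) (1 - Real.exp (-((1 - Real.exp (-1)) * (1 / (2 * K)))))

theorem one_sub_exp_neg_one_pos : 0 < 1 - Real.exp (-1) :=
  sub_pos.2 (Real.exp_lt_one_iff.2 (by norm_num))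

theorem ellLowerConst_pos {K : ℝ} (hK : 0 < K) : 0 < ellLowerConst K := by
  have h := one_sub_exp_neg_one_pos
  refine lt_min (lt_min (by norm_num) (by positivity)) (sub_pos.2 (Real.exp_lt_one_iff.2 ?_))
  have : 0 < (1 - Real.exp (-1)) * (1 / (2 * K)) := by positivity
  linarith

/-- One of the two sums carries at least half of `1 / K`. If it is the small entries, the Laplace
transform bound applies to the truncated `p`-th powers, which lie in `[0, 1]`; if it is the large
ones, the maximum is already big enough. -/
theorem le_lintegral_ellNorm {p : ℝ≥0∞} (hp : 1 ≤ p) {K : ℝ} (hK : 0 < K) {Y : ι → Ω → ℝ}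
    (hY : ∀ i, Measurable (Y i)) (hind : iIndepFun Y P)
    (hsum : ENNReal.ofReal (1 / K) ≤
      ∑ i, (∫⁻ ω, ENNReal.ofReal (if |Y i ω| ≤ 1 then powCost p |Y i ω| else 0) ∂P +
        ∫⁻ ω, ENNReal.ofReal (if 1 < |Y i ω| then |Y i ω| else 0) ∂P)) :
    ENNReal.ofReal (ellLowerConst K) ≤ ∫⁻ ω, ENNReal.ofReal (ellNorm p fun i => Y i ω) ∂P := by
  rw [Finset.sum_add_distrib] at hsum
  set A := ∑ i, ∫⁻ ω, ENNReal.ofReal (if |Y i ω| ≤ 1 then powCost p |Y i ω| else 0) ∂P with hA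
  set B := ∑ i, ∫⁻ ω, ENNReal.ofReal (if 1 < |Y i ω| then |Y i ω| else 0) ∂P with hB
  have hAB : ENNReal.ofReal (1 / (2 * K)) ≤ A ∨ ENNReal.ofReal (1 / (2 * K)) ≤ B := by
    by_contra! h
    have := hsum.trans_lt (ENNReal.add_lt_add h.1 h.2)
    rw [← ENNReal.ofReal_add (by positivity) (by positivity)] at this
    refine this.ne ?_
    congr 1; field_simp; norm_num
  rcases hAB with h | h
  · by_cases hp' : p = ∞
    -- For `p = ∞` small entries have zero cost, so their sum cannot be the dominant one.
    · exfalso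
      subst hp'
      have : A = 0 := by simp [hA, powCost]
      rw [this, nonpos_iff_eq_zero, ENNReal.ofReal_eq_zero] at h
      have : 0 < 1 / (2 * K) := by positivity
      linarith
    · have hP := toReal_pos_of_one_le hp hp'
      set g : ℝ → ℝ := fun y => if |y| ≤ 1 then |y| ^ p.toReal else 0 with hg
      have hgm : Measurable g := Measurable.ite (measurableSet_le measurable_norm measurable_const)
        (measurable_norm.pow_const _) measurable_const
      have hg0 : ∀ y, 0 ≤ g y := fun y => by simp only [hg]; split_ifs <;> positivity
      have hg1 : ∀ y, g y ≤ 1 := fun y => by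
        simp only [hg]; split_ifs with hy
        exacts [Real.rpow_le_one (abs_nonneg _) hy hP.le, zero_le_one]
      have hint : ∀ i, Integrable (fun ω => g (Y i ω)) P := fun i =>
        Integrable.of_bound (hgm.comp (hY i)).aestronglyMeasurable 1 (ae_of_all _ fun ω => by
          rw [Real.norm_of_nonneg (hg0 _)]; exact hg1 _)
      have hAg : A = ENNReal.ofReal (∑ i, ∫ ω, g (Y i ω) ∂P) := by
        rw [ENNReal.ofReal_sum_of_nonneg fun i _ => integral_nonneg fun ω => hg0 _, hA]
        refine Finset.sum_congr rfl fun i _ => ?_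
        rw [ofReal_integral_eq_lintegral_ofReal (hint i) (ae_of_all _ fun ω => hg0 _)]
        simp only [hg, powCost, hp', if_false]
      have hS0 : 0 ≤ ∑ i, ∫ ω, g (Y i ω) ∂P :=
        Finset.sum_nonneg fun i _ => integral_nonneg fun ω => hg0 _
      rw [hAg, ENNReal.ofReal_le_ofReal_iff hS0] at h
      have hlap := one_sub_exp_le_integral (P := P) (Z := fun i ω => g (Y i ω))
        (fun i => hgm.comp (hY i)) (fun i ω => hg0 _) (fun i ω => hg1 _)
        (hind.comp (fun _ => g) fun _ => hgm)
      have hc : ellLowerConst K ≤ ∫ ω, (1 - Real.exp (-∑ i, g (Y i ω))) ∂P := by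
        refine (min_le_right _ _).trans (le_trans ?_ hlap)
        have := one_sub_exp_neg_one_pos.le
        gcongr
      have hm : Measurable fun ω => 1 - Real.exp (-∑ i, g (Y i ω)) := by
        have : ∀ i, Measurable fun ω => g (Y i ω) := fun i => hgm.comp (hY i)
        fun_prop
      have hpos : ∀ ω, 0 ≤ 1 - Real.exp (-∑ i, g (Y i ω)) := fun ω => by
        have : 0 ≤ ∑ i, g (Y i ω) := Finset.sum_nonneg fun i _ => hg0 _
        have : Real.exp (-∑ i, g (Y i ω)) ≤ 1 := Real.exp_le_one_iff.2 (by linarith)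
        linarith
      refine (ENNReal.ofReal_le_ofReal hc).trans ?_
      rw [ofReal_integral_eq_lintegral_ofReal]
      · exact lintegral_mono fun ω => ENNReal.ofReal_le_ofReal
          (one_sub_exp_le_ellNorm hp hp' fun i => Y i ω)
      · refine Integrable.of_bound hm.aestronglyMeasurable 1 (ae_of_all _ fun ω => ?_)
        rw [Real.norm_of_nonneg (hpos ω)]
        linarith [Real.exp_pos (-∑ i, g (Y i ω))]
      · exact ae_of_all _ hpos
  · refine le_trans ?_ (min_le_lintegral_ellNorm hp hY hind)
    have half : ENNReal.ofReal (1 / 2) = 1 / 2 := by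
      rw [ENNReal.ofReal_div_of_pos two_pos]; simp
    refine le_min ?_ ?_
    · rw [← half]
      exact ENNReal.ofReal_le_ofReal ((min_le_left _ _).trans (min_le_left _ _))
    · refine le_trans ?_ (mul_le_mul_right h (1 / 2))
      rw [← half, ← ENNReal.ofReal_mul (by norm_num)]
      refine ENNReal.ofReal_le_ofReal (((min_le_left _ _).trans (min_le_right _ _)).trans
        (le_of_eq ?_))
      field_simp; norm_num

end RandomVectors

/-! ### The kernel `φ` and its comparison with truncated powers. -/

section Kernel

/-- The function `φ` with `M_{X,p}(s) = 𝔼 φ(s|X|)`. -/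
noncomputable def orliczKernel (p : ℝ≥0∞) (u : ℝ) : ℝ :=
  if p = ∞ then max (u - 1) 0
  else if u ≤ 1 then u ^ p.toReal / (p.toReal - 1) else p.toReal / (p.toReal - 1) * u - 1

/-- The factor `p / (p - 1)`, which is `1` for `p = ∞`. -/
noncomputable def conjFactor (p : ℝ≥0∞) : ℝ := if p = ∞ then 1 else p.toReal / (p.toReal - 1)

/-- A constant such that `powCost p u ≤ kernelConst p * orliczKernel p u` for `0 ≤ u < 2`. -/
noncomputable def kernelConst (p : ℝ≥0∞) : ℝ :=
  if p = ∞ then 1 else (p.toReal - 1) * 2 ^ p.toReal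

/-- The integrand (including the factor `p / (p - 1)`) in the definition of `M_{X,p}`. -/
noncomputable def orliczSlope (p : ℝ≥0∞) (t x : ℝ) : ℝ :=
  conjFactor p * ((if x ≤ 1 / t then (if p = ∞ then 0 else t ^ (p.toReal - 1) * x ^ p.toReal)
    else 0) + if 1 / t ≤ x then x else 0)

variable {p : ℝ≥0∞}

theorem one_lt_toReal (hp : 1 < p) (hp' : p ≠ ∞) : 1 < p.toReal := by
  simpa using (ENNReal.toReal_lt_toReal ENNReal.one_ne_top hp').2 hp

theorem one_le_conjFactor (hp : 1 < p) : 1 ≤ conjFactor p := by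
  unfold conjFactor
  split_ifs with h
  · exact le_rfl
  · have := one_lt_toReal hp h
    rw [one_le_div (by linarith)]
    linarith

theorem conjFactor_pos (hp : 1 < p) : 0 < conjFactor p :=
  one_pos.trans_le (one_le_conjFactor hp)

theorem kernelConst_pos (hp : 1 < p) : 0 < kernelConst p := by
  unfold kernelConst
  split_ifs with h
  · exact one_pos
  · have := one_lt_toReal hp h
    have : 0 < p.toReal - 1 := by linarith
    positivity

theorem measurable_orliczKernel : Measurable (orliczKernel p) := by
  unfold orliczKernel
  split_ifs
  · fun_prop
  · exact Measurable.ite measurableSet_Iic (by fun_prop) (by fun_prop)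

theorem sub_one_le_orliczKernel (hp : 1 < p) {u : ℝ} (hu : 0 ≤ u) :
    u - 1 ≤ orliczKernel p u := by
  unfold orliczKernel
  split_ifs with h h1
  · exact le_max_left _ _
  · have := one_lt_toReal hp h
    have : 0 < p.toReal - 1 := by linarith
    have : 0 ≤ u ^ p.toReal / (p.toReal - 1) := by positivity
    linarith
  · have h2 := one_le_conjFactor hp
    simp only [conjFactor, h, if_false] at h2
    nlinarith

theorem orliczKernel_nonneg (hp : 1 < p) {u : ℝ} (hu : 0 ≤ u) : 0 ≤ orliczKernel p u := by
  rcases le_total u 1 with h | h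
  · unfold orliczKernel
    split_ifs with h'
    · exact le_max_right _ _
    · have := one_lt_toReal hp h'
      have : 0 < p.toReal - 1 := by linarith
      positivity
  · linarith [sub_one_le_orliczKernel hp hu]

/-- For finite `p`, `(p - 1) φ(u)` equals `u ^ p` up to `1` and is at least `1` beyond, where `u ^
p` is still below `2 ^ p`. -/
theorem powCost_le_kernelConst_mul (hp : 1 < p) {u : ℝ} (hu : 0 ≤ u) (hu2 : u < 2) :
    powCost p u ≤ kernelConst p * orliczKernel p u := by
  by_cases h : p = ∞
  · have := mul_nonneg (kernelConst_pos hp).le (orliczKernel_nonneg hp hu)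
    simpa [powCost, h] using h ▸ this
  · have h1 := one_lt_toReal hp h
    have h2 : 0 < p.toReal - 1 := by linarith
    simp only [powCost, kernelConst, orliczKernel, h, if_false]
    split_ifs with hu1
    · rw [mul_comm (p.toReal - 1), mul_assoc, mul_div_cancel₀ _ h2.ne']
      have := Real.one_le_rpow (x := 2) (z := p.toReal) (by norm_num) (by linarith)
      have h0 : 0 ≤ u ^ p.toReal := by positivity
      nlinarith
    · have e : (p.toReal - 1) * 2 ^ p.toReal * (p.toReal / (p.toReal - 1) * u - 1) =
          2 ^ p.toReal * (p.toReal * u - (p.toReal - 1)) := by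
        field_simp
      rw [e]
      have h3 : u ^ p.toReal ≤ 2 ^ p.toReal := Real.rpow_le_rpow hu hu2.le (by linarith)
      have h4 : 1 ≤ p.toReal * u - (p.toReal - 1) := by nlinarith
      have h0 : 0 ≤ (2 : ℝ) ^ p.toReal := by positivity
      nlinarith

theorem orliczKernel_le (hp : 1 < p) {u : ℝ} (hu : 0 ≤ u) :
    orliczKernel p u ≤
      conjFactor p * ((if u ≤ 1 then powCost p u else 0) + if 1 < u then u else 0) := by
  by_cases h : p = ∞
  · simp only [orliczKernel, conjFactor, powCost, h, if_true]
    split_ifs <;> simp <;> linarith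
  · have h1 := one_lt_toReal hp h
    have h2 : 0 < p.toReal - 1 := by linarith
    simp only [orliczKernel, conjFactor, powCost, h, if_false]
    by_cases hu1 : u ≤ 1
    · have h0 : 0 ≤ u ^ p.toReal := by positivity
      simp only [hu1, hu1.not_gt, if_true, if_false, add_zero]
      rw [div_mul_eq_mul_div]
      gcongr
      nlinarith
    · simp only [hu1, not_le.1 hu1, if_true, if_false, zero_add]
      linarith

theorem orliczKernel_le_rpow (hp : 1 < p) {q : ℝ} (hq : 1 ≤ q) (hqp : ENNReal.ofReal q ≤ p)
    {u : ℝ} (hu : 0 ≤ u) : orliczKernel p u ≤ conjFactor p * u ^ q := by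
  refine (orliczKernel_le hp hu).trans ?_
  have := (conjFactor_pos hp).le
  gcongr
  by_cases hu1 : u ≤ 1
  · simp only [hu1, hu1.not_gt, if_true, if_false, add_zero, powCost]
    split_ifs with h
    · positivity
    · exact Real.rpow_le_rpow_of_exponent_ge_of_imp hu hu1
        ((ENNReal.ofReal_le_iff_le_toReal h).1 hqp) (by
          intro _ h'; linarith [one_lt_toReal hp h])
  · simp only [hu1, not_le.1 hu1, if_true, if_false, zero_add]
    exact Real.self_le_rpow_of_one_le (not_le.1 hu1).le hq

theorem orliczKernel_zero (hp : 1 < p) : orliczKernel p 0 = 0 := by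
  unfold orliczKernel
  split_ifs with h
  · simp
  · have := one_lt_toReal hp h
    rw [Real.zero_rpow (by linarith), zero_div]
  · exact absurd zero_le_one ‹_›

theorem mul_rpow_sub_one {t x s : ℝ} (ht : 0 ≤ t) (hx : 0 ≤ x) (hs : 1 < s) :
    t ^ (s - 1) * x ^ s = x * (t * x) ^ (s - 1) := by
  rw [Real.mul_rpow ht hx]
  rcases hx.eq_or_lt with rfl | hx
  · simp [Real.zero_rpow (by linarith : s ≠ 0)]
  · rw [Real.rpow_sub_one hx.ne']
    field_simp

theorem orliczSlope_nonneg (hp : 1 < p) {t x : ℝ} (ht : 0 ≤ t) (hx : 0 ≤ x) :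
    0 ≤ orliczSlope p t x := by
  have := (conjFactor_pos hp).le
  unfold orliczSlope
  split_ifs <;> positivity

theorem small_part_le (hp : 1 < p) (hp' : p ≠ ∞) {t x : ℝ} (ht : 0 < t) (hx : 0 ≤ x)
    (h : x ≤ 1 / t) : t ^ (p.toReal - 1) * x ^ p.toReal ≤ x := by
  have h1 := one_lt_toReal hp hp'
  rw [mul_rpow_sub_one ht.le hx h1]
  have : t * x ≤ 1 := by rwa [le_div_iff₀ ht, mul_comm] at h
  exact mul_le_of_le_one_right hx (Real.rpow_le_one (by positivity) this (by linarith))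

theorem orliczSlope_le (hp : 1 < p) {t x : ℝ} (ht : 0 < t) (hx : 0 ≤ x) :
    orliczSlope p t x ≤ conjFactor p * (x + x) := by
  have := (conjFactor_pos hp).le
  unfold orliczSlope
  gcongr
  · split_ifs with h1 h2
    exacts [hx, small_part_le hp h2 ht hx h1, hx]
  · split_ifs
    exacts [le_rfl, hx]

theorem measurable_orliczSlope : Measurable (Function.uncurry (orliczSlope p)) := by
  unfold orliczSlope Function.uncurry
  refine (Measurable.add (Measurable.ite ?_ ?_ measurable_const)
    (Measurable.ite ?_ measurable_snd measurable_const)).const_mul _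
  · exact measurableSet_le (by fun_prop) (by fun_prop)
  · split_ifs <;> fun_prop
  · exact measurableSet_le (by fun_prop) (by fun_prop)

theorem intervalIntegral_orliczSlope_of_le (hp : 1 < p) {s x : ℝ} (hs : 0 ≤ s) (hx : 0 < x)
    (h : s ≤ 1 / x) : ∫ t in (0 : ℝ)..s, orliczSlope p t x =
      if p = ∞ then 0 else (s * x) ^ p.toReal / (p.toReal - 1) := by
  have hae : ∀ᵐ t : ℝ, t ∈ Set.uIoc 0 s → orliczSlope p t x =
      conjFactor p * (if p = ∞ then 0 else t ^ (p.toReal - 1) * x ^ p.toReal) := by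
    -- Both closed conditions hold at `t = 1 / x`, so the slope counts both terms there; this is a
    -- single point in `t`.
    have : ∀ᵐ t : ℝ, t ≠ 1 / x := by simp [ae_iff]
    filter_upwards [this] with t htx ht
    rw [Set.uIoc_of_le hs] at ht
    have hlt : x < 1 / t := by
      rw [lt_one_div hx ht.1]
      exact lt_of_le_of_ne (ht.2.trans h) htx
    simp only [orliczSlope, hlt.le, hlt.not_ge, if_true, if_false, add_zero]
  rw [intervalIntegral.integral_congr_ae hae]
  split_ifs with hp'
  · simp
  · have h1 := one_lt_toReal hp hp'
    rw [intervalIntegral.integral_const_mul, intervalIntegral.integral_mul_const,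
      integral_rpow (Or.inl (by linarith)), Real.mul_rpow hs hx.le, conjFactor, if_neg hp',
      sub_add_cancel, Real.zero_rpow (by linarith)]
    have : p.toReal - 1 ≠ 0 := by linarith
    field_simp
    ring

theorem intervalIntegral_orliczSlope_of_ge {s x : ℝ} (hx : 0 < x)
    (h : 1 / x ≤ s) : ∫ t in (1 / x)..s, orliczSlope p t x = conjFactor p * (s * x - 1) := by
  have hae : ∀ᵐ t : ℝ, t ∈ Set.uIoc (1 / x) s → orliczSlope p t x = conjFactor p * x := by
    filter_upwards with t ht
    rw [Set.uIoc_of_le h] at ht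
    have ht0 : 0 < t := lt_trans (by positivity) ht.1
    have hlt : 1 / t < x := by
      rw [one_div_lt ht0 hx]
      exact ht.1
    simp only [orliczSlope, hlt.le, hlt.not_ge, if_true, if_false, zero_add]
  rw [intervalIntegral.integral_congr_ae hae, intervalIntegral.integral_const, smul_eq_mul]
  field_simp

theorem intervalIntegrable_orliczSlope (hp : 1 < p) {a b x : ℝ} (ha : 0 ≤ a) (hb : 0 ≤ b)
    (hx : 0 ≤ x) : IntervalIntegrable (fun t => orliczSlope p t x) volume a b := by
  refine IntervalIntegrable.mono_fun' (g := fun _ => conjFactor p * (x + x))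
    intervalIntegrable_const
    (measurable_orliczSlope.comp (measurable_id.prodMk measurable_const)).aestronglyMeasurable ?_
  filter_upwards [ae_restrict_mem measurableSet_uIoc] with t ht
  have ht0 : 0 < t := lt_of_le_of_lt (le_min ha hb) ht.1
  rw [Real.norm_of_nonneg (orliczSlope_nonneg hp ht0.le hx)]
  exact orliczSlope_le hp ht0 hx

/-- The slope changes regime at `t = 1 / x`: it is a multiple of `t ^ (p - 1)` before (zero if `p =
∞`) and constant after. -/
theorem intervalIntegral_orliczSlope (hp : 1 < p) {s x : ℝ} (hs : 0 ≤ s) (hx : 0 ≤ x) :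
    ∫ t in (0 : ℝ)..s, orliczSlope p t x = orliczKernel p (s * x) := by
  rcases hx.eq_or_lt with rfl | hx
  · rw [mul_zero, orliczKernel_zero hp]
    have : ∀ t, orliczSlope p t 0 = 0 := fun t => by
      unfold orliczSlope
      split_ifs with h1 h2 <;> simp
      all_goals
        have := one_lt_toReal hp ‹_›
        simp [Real.zero_rpow (by linarith : p.toReal ≠ 0)]
    simp [this]
  rcases le_total s (1 / x) with h | h
  · rw [intervalIntegral_orliczSlope_of_le hp hs hx h]
    have : s * x ≤ 1 := by rwa [le_div_iff₀ hx] at h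
    simp [orliczKernel, this]
  · have hx' : 0 ≤ 1 / x := by positivity
    rw [← intervalIntegral.integral_add_adjacent_intervals
      (intervalIntegrable_orliczSlope hp le_rfl hx' hx.le)
      (intervalIntegrable_orliczSlope hp hx' hs hx.le),
      intervalIntegral_orliczSlope_of_le hp hx' hx le_rfl, intervalIntegral_orliczSlope_of_ge hx h]
    have hsx : 1 ≤ s * x := by rwa [div_le_iff₀ hx] at h
    unfold orliczKernel conjFactor
    rw [one_div_mul_cancel hx.ne', Real.one_rpow]
    split_ifs with hp' h1
    · simp [max_eq_left (sub_nonneg.2 hsx)]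
    · have h1 : s * x = 1 := le_antisymm h1 hsx
      simp [h1]
    · have h1 := one_lt_toReal hp hp'
      have : p.toReal - 1 ≠ 0 := by linarith
      field_simp
      ring

end Kernel

/-! ### The representation `M(s) = 𝔼 φ(s|X|)` and the bounds it yields. -/

section OrliczFun

variable {p : ℝ≥0∞}

theorem orliczFun_eq_map {Ω : Type*} [MeasurableSpace Ω] {P : Measure Ω} {X : Ω → ℝ}
    (hX : AEMeasurable X P) : orliczFun P X p = orliczFun (P.map X) id p := by
  have h1 : ∀ t : ℝ, ∫ x in {x | 1 / t ≤ |id x|}, |id x| ∂(P.map X) =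
      ∫ ω in {ω | 1 / t ≤ |X ω|}, |X ω| ∂P := fun t =>
    setIntegral_map (f := fun x : ℝ => |x|) (measurableSet_le measurable_const measurable_norm)
      measurable_norm.aestronglyMeasurable hX
  have h2 : ∀ t : ℝ, ∫ x in {x | |id x| ≤ 1 / t},
      t ^ (p.toReal - 1) * |id x| ^ p.toReal ∂(P.map X) =
      ∫ ω in {ω | |X ω| ≤ 1 / t}, t ^ (p.toReal - 1) * |X ω| ^ p.toReal ∂P := fun t =>
    setIntegral_map (f := fun x : ℝ => t ^ (p.toReal - 1) * |x| ^ p.toReal)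
      (measurableSet_le measurable_norm measurable_const)
      ((measurable_norm.pow_const _).const_mul _).aestronglyMeasurable hX
  ext s
  simp only [orliczFun, h1, h2]

variable {μ : Measure ℝ}

theorem integrable_small_part (hp : 1 < p) (hp' : p ≠ ∞) (hμ : Integrable id μ) {t : ℝ}
    (ht : 0 < t) :
    Integrable (fun x => if |x| ≤ 1 / t then t ^ (p.toReal - 1) * |x| ^ p.toReal else 0) μ := by
  refine hμ.abs.mono' (Measurable.ite (measurableSet_le measurable_norm measurable_const)
    ((measurable_norm.pow_const _).const_mul _) measurable_const).aestronglyMeasurable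
    (ae_of_all _ fun x => ?_)
  rw [Real.norm_of_nonneg (by split_ifs <;> positivity)]
  split_ifs with h
  exacts [small_part_le hp hp' ht (abs_nonneg x) h, abs_nonneg _]

theorem integrable_large_part (hμ : Integrable id μ) (t : ℝ) :
    Integrable (fun x => if 1 / t ≤ |x| then |x| else 0) μ := by
  refine hμ.abs.mono' (Measurable.ite (measurableSet_le measurable_const measurable_norm)
    measurable_norm measurable_const).aestronglyMeasurable (ae_of_all _ fun x => ?_)
  rw [Real.norm_of_nonneg (by split_ifs <;> positivity)]
  split_ifs with h
  exacts [le_rfl, abs_nonneg _]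

theorem orliczFun_eq_integral_slope (hp : 1 < p) (hμ : Integrable id μ) {s : ℝ} (hs : 0 ≤ s) :
    orliczFun μ id p s = ∫ t in (0 : ℝ)..s, ∫ x, orliczSlope p t |x| ∂μ := by
  have hL : ∀ t : ℝ, ∫ x in {x | 1 / t ≤ |id x|}, |id x| ∂μ =
      ∫ x, (if 1 / t ≤ |x| then |x| else 0) ∂μ := fun t => by
    have hm : MeasurableSet {x : ℝ | 1 / t ≤ |x|} :=
      measurableSet_le measurable_const measurable_norm
    exact (integral_indicator hm).symm
  have hS : ∀ t : ℝ, ∫ x in {x | |id x| ≤ 1 / t}, t ^ (p.toReal - 1) * |id x| ^ p.toReal ∂μ =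
      ∫ x, (if |x| ≤ 1 / t then t ^ (p.toReal - 1) * |x| ^ p.toReal else 0) ∂μ := fun t => by
    have hm : MeasurableSet {x : ℝ | |x| ≤ 1 / t} :=
      measurableSet_le measurable_norm measurable_const
    exact (integral_indicator hm).symm
  simp only [orliczFun, hL, hS]
  split_ifs with hp'
  · simp [orliczSlope, conjFactor, hp']
  · rw [← intervalIntegral.integral_const_mul, intervalIntegral.integral_of_le hs,
      intervalIntegral.integral_of_le hs]
    refine setIntegral_congr_fun measurableSet_Ioc fun t ht => ?_
    simp only [orliczSlope, conjFactor, hp', if_false]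
    rw [integral_const_mul, ← integral_add (integrable_small_part hp hp' hμ ht.1)
      (integrable_large_part hμ t)]

theorem measurable_orliczKernel_comp (s : ℝ) :
    Measurable fun x : ℝ => orliczKernel p (s * |x|) :=
  measurable_orliczKernel.comp (by fun_prop)

theorem integrable_orliczKernel (hp : 1 < p) (hμ : Integrable id μ) {s : ℝ} (hs : 0 ≤ s) :
    Integrable (fun x => orliczKernel p (s * |x|)) μ := by
  refine ((hμ.abs.const_mul s).const_mul (conjFactor p)).mono'
    (measurable_orliczKernel_comp s).aestronglyMeasurable (ae_of_all _ fun x => ?_)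
  have h0 : 0 ≤ s * |x| := by positivity
  rw [Real.norm_of_nonneg (orliczKernel_nonneg hp h0)]
  simpa using orliczKernel_le_rpow hp le_rfl (by simpa using hp.le) h0

variable [IsProbabilityMeasure μ]

theorem orliczFun_eq_integral (hp : 1 < p) (hμ : Integrable id μ) {s : ℝ} (hs : 0 ≤ s) :
    orliczFun μ id p s = ∫ x, orliczKernel p (s * |x|) ∂μ := by
  rw [orliczFun_eq_integral_slope hp hμ hs, intervalIntegral.integral_of_le hs,
    integral_integral_swap]
  · simp only [← intervalIntegral.integral_of_le hs,
      intervalIntegral_orliczSlope hp hs (abs_nonneg _)]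
  · have hbound : Integrable (fun z : ℝ × ℝ => 1 * (conjFactor p * (|z.2| + |z.2|)))
        ((volume.restrict (Set.Ioc 0 s)).prod μ) :=
      (integrable_const (1 : ℝ)).mul_prod ((hμ.abs.add hμ.abs).const_mul _)
    refine hbound.mono' (measurable_orliczSlope.comp
      (measurable_fst.prodMk measurable_snd.abs)).aestronglyMeasurable ?_
    have hpos : ∀ᵐ z : ℝ × ℝ ∂((volume.restrict (Set.Ioc 0 s)).prod μ), z.1 ∈ Set.Ioc 0 s :=
      Measure.quasiMeasurePreserving_fst.ae (ae_restrict_mem measurableSet_Ioc)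
    filter_upwards [hpos] with z hz
    rw [one_mul, Function.uncurry,
      Real.norm_of_nonneg (orliczSlope_nonneg hp hz.1.le (abs_nonneg _))]
    exact orliczSlope_le hp hz.1 (abs_nonneg _)

theorem ofReal_orliczFun (hp : 1 < p) (hμ : Integrable id μ) {s : ℝ} (hs : 0 ≤ s) :
    ENNReal.ofReal (orliczFun μ id p s) = ∫⁻ x, ENNReal.ofReal (orliczKernel p (s * |x|)) ∂μ := by
  rw [orliczFun_eq_integral hp hμ hs,
    ofReal_integral_eq_lintegral_ofReal (integrable_orliczKernel hp hμ hs)]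
  exact ae_of_all _ fun x => orliczKernel_nonneg hp (by positivity)

theorem orliczFun_nonneg (hp : 1 < p) (hμ : Integrable id μ) {s : ℝ} (hs : 0 ≤ s) :
    0 ≤ orliczFun μ id p s := by
  rw [orliczFun_eq_integral hp hμ hs]
  exact integral_nonneg fun x => orliczKernel_nonneg hp (by positivity)

/-- Serves to show that `M` is small near `0`, so that the set defining the Luxemburg norm is
nonempty. -/
theorem orliczFun_le_rpow (hp : 1 < p) {q : ℝ} (hq : 1 ≤ q) (hqp : ENNReal.ofReal q ≤ p)
    (hμ : Integrable id μ) (hμq : Integrable (fun x => |x| ^ q) μ) {s : ℝ} (hs : 0 ≤ s) :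
    orliczFun μ id p s ≤ conjFactor p * (∫ x, |x| ^ q ∂μ) * s ^ q := by
  rw [orliczFun_eq_integral hp hμ hs, mul_right_comm, ← integral_const_mul]
  refine integral_mono (integrable_orliczKernel hp hμ hs) (hμq.const_mul _) fun x => ?_
  refine (orliczKernel_le_rpow hp hq hqp (by positivity)).trans (le_of_eq ?_)
  rw [Real.mul_rpow hs (abs_nonneg _), mul_assoc]

theorem lintegral_powCost_le (hp : 1 < p) (hμ : Integrable id μ) (a : ℝ) :
    ∫⁻ x, ENNReal.ofReal (if |a * x| < 2 then powCost p |a * x| else 0) ∂μ ≤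
      ENNReal.ofReal (kernelConst p) * ENNReal.ofReal (orliczFun μ id p |a|) := by
  rw [ofReal_orliczFun hp hμ (abs_nonneg a), ← lintegral_const_mul _
    (measurable_orliczKernel_comp _).ennreal_ofReal]
  refine lintegral_mono fun x => ?_
  rw [← ENNReal.ofReal_mul (kernelConst_pos hp).le]
  refine ENNReal.ofReal_le_ofReal ?_
  rw [abs_mul]
  have h0 : 0 ≤ |a| * |x| := by positivity
  split_ifs with h
  · exact powCost_le_kernelConst_mul hp h0 h
  · exact mul_nonneg (kernelConst_pos hp).le (orliczKernel_nonneg hp h0)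

theorem ofReal_orliczFun_le (hp : 1 < p) (hμ : Integrable id μ) (a : ℝ) :
    ENNReal.ofReal (orliczFun μ id p |a|) ≤ ENNReal.ofReal (conjFactor p) *
      (∫⁻ x, ENNReal.ofReal (if |a * x| ≤ 1 then powCost p |a * x| else 0) ∂μ +
        ∫⁻ x, ENNReal.ofReal (if 1 < |a * x| then |a * x| else 0) ∂μ) := by
  have hm : Measurable fun x : ℝ => if |a * x| ≤ 1 then powCost p |a * x| else 0 :=
    Measurable.ite (measurableSet_le (by fun_prop) measurable_const)
      ((measurable_powCost p).comp (by fun_prop)) measurable_const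
  have hm' : Measurable fun x : ℝ => if 1 < |a * x| then |a * x| else 0 :=
    Measurable.ite (measurableSet_lt measurable_const (by fun_prop)) (by fun_prop) measurable_const
  rw [ofReal_orliczFun hp hμ (abs_nonneg a), ← lintegral_add_left hm.ennreal_ofReal,
    ← lintegral_const_mul' _ _ ENNReal.ofReal_ne_top]
  refine lintegral_mono fun x => ?_
  have h1 : 0 ≤ if |a * x| ≤ 1 then powCost p |a * x| else 0 := by
    split_ifs
    exacts [powCost_nonneg p (abs_nonneg _), le_rfl]
  have h2 : 0 ≤ if 1 < |a * x| then |a * x| else 0 := by split_ifs <;> positivity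
  rw [← ENNReal.ofReal_add h1 h2, ← ENNReal.ofReal_mul (conjFactor_pos hp).le, ← abs_mul]
  exact ENNReal.ofReal_le_ofReal (orliczKernel_le hp (abs_nonneg _))

/-- The weight `t ^ (-q - 1)` is integrated near `t = 2 / |x|`, where `φ(t|x|)` is bounded below;
this window alone contributes a multiple of `|x| ^ q`. Averaged over `x`, the right side becomes the
integral in the integral condition. -/
theorem tail_le_lintegral_orliczKernel (hp : 1 < p) {q s : ℝ} (hq : 1 < q) (hs : 0 < s) (x : ℝ) :
    ENNReal.ofReal (if |s * x| < 2 then 0 else |s * x| ^ q) ≤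
      ENNReal.ofReal (2 ^ (q + 3) * s ^ q) *
        ∫⁻ t in Set.Ioc 0 s, ENNReal.ofReal (orliczKernel p (t * |x|) / t ^ q / t) := by
  split_ifs with h
  · simp
  rw [abs_mul, abs_of_pos hs, not_lt] at h
  have hx : 0 < |x| := by
    by_contra hx
    nlinarith [abs_nonneg x]
  set y := |x| with hy
  -- On this window `t * y > 3 / 2`, so `φ(t * y) ≥ 1 / 2` for every `p`, including `p = ∞`, where
  -- `φ` vanishes up to `1`. The right end is at most `s` exactly because `s * y ≥ 2`, which is why
  -- the truncation level is `2`. The window has length `1 / (2 * y)`.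
  have hsub : Set.Ioc (3 / (2 * y)) (2 / y) ⊆ Set.Ioc 0 s := fun t ht =>
    ⟨lt_trans (by positivity) ht.1, ht.2.trans (by rwa [div_le_iff₀ hx])⟩
  have hlow : ∀ t ∈ Set.Ioc (3 / (2 * y)) (2 / y),
      ENNReal.ofReal (1 / 2 / (2 / y) ^ q / (2 / y)) ≤
        ENNReal.ofReal (orliczKernel p (t * y) / t ^ q / t) := fun t ht => by
    have ht0 : 0 < t := lt_trans (by positivity) ht.1
    have h1 : 3 / 2 < t * y := by
      have := ht.1
      rw [div_lt_iff₀ (by positivity)] at this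
      linarith
    have h2 := sub_one_le_orliczKernel hp (by positivity : 0 ≤ t * y)
    have h3 := ht.2
    refine ENNReal.ofReal_le_ofReal ?_
    have h4 : 0 ≤ orliczKernel p (t * y) := by linarith
    gcongr
    linarith
  have hvol : ENNReal.ofReal (1 / 2 / (2 / y) ^ q / (2 / y)) * ENNReal.ofReal (1 / (2 * y)) ≤
      ∫⁻ t in Set.Ioc 0 s, ENNReal.ofReal (orliczKernel p (t * y) / t ^ q / t) := by
    refine le_trans ?_ (lintegral_mono_set hsub)
    have := setLIntegral_mono' (μ := volume) measurableSet_Ioc hlow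
    rw [setLIntegral_const, Real.volume_Ioc] at this
    have e : 1 / (2 * y) = 2 / y - 3 / (2 * y) := by
      field_simp
      norm_num
    rwa [e]
  refine le_trans (le_of_eq ?_) (mul_le_mul_right hvol _)
  rw [← ENNReal.ofReal_mul (by positivity), ← ENNReal.ofReal_mul (by positivity), abs_mul,
    abs_of_pos hs, ← hy]
  congr 1
  rw [Real.mul_rpow hs.le hx.le, Real.div_rpow two_pos.le hx.le, Real.rpow_add two_pos]
  have : (2 : ℝ) ^ (3 : ℝ) = 8 := by norm_num
  rw [this]
  field_simp
  norm_num

theorem lintegral_tail_le (hp : 1 < p) {q C : ℝ} (hq : 1 < q) (hμ : Integrable id μ)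
    (hC : IntegralCondition (orliczFun μ id p) q C) (a : ℝ) (ha : orliczFun μ id p |a| ≤ 1) :
    ∫⁻ x, ENNReal.ofReal (if |a * x| < 2 then 0 else |a * x| ^ q) ∂μ ≤
      ENNReal.ofReal (2 ^ (q + 3) * C) * ENNReal.ofReal (orliczFun μ id p |a|) := by
  rcases (abs_nonneg a).eq_or_lt with h0 | hs
  · simp [abs_eq_zero.1 h0.symm]
  set s := |a| with hs'
  have hm : Measurable (Function.uncurry fun t x : ℝ =>
      ENNReal.ofReal (orliczKernel p (t * |x|) / t ^ q / t)) := by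
    have : Measurable fun z : ℝ × ℝ => orliczKernel p (z.1 * |z.2|) :=
      measurable_orliczKernel.comp (by fun_prop)
    unfold Function.uncurry
    fun_prop
  have hswap : ∫⁻ t in Set.Ioc 0 s, ENNReal.ofReal (orliczFun μ id p t / t ^ q / t) =
      ∫⁻ x, (∫⁻ t in Set.Ioc 0 s, ENNReal.ofReal (orliczKernel p (t * |x|) / t ^ q / t)) ∂μ := by
    refine Eq.trans ?_ (lintegral_lintegral_swap hm.aemeasurable)
    refine setLIntegral_congr_fun measurableSet_Ioc fun t ht => ?_
    have ht0 := ht.1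
    have e : ∀ y : ℝ, y / t ^ q / t = (t ^ q * t)⁻¹ * y := fun y => by
      field_simp
    simp only [e]
    rw [ENNReal.ofReal_mul (by positivity), ofReal_orliczFun hp hμ ht.1.le,
      ← lintegral_const_mul _ (measurable_orliczKernel_comp _).ennreal_ofReal]
    refine lintegral_congr fun x => ?_
    rw [ENNReal.ofReal_mul (by positivity)]
  have hle := hC s hs ha
  rw [hswap] at hle
  have hmono : ∫⁻ x, ENNReal.ofReal (if |a * x| < 2 then 0 else |a * x| ^ q) ∂μ ≤
      ENNReal.ofReal (2 ^ (q + 3) * s ^ q) * ∫⁻ x, (∫⁻ t in Set.Ioc 0 s,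
        ENNReal.ofReal (orliczKernel p (t * |x|) / t ^ q / t)) ∂μ := by
    rw [← lintegral_const_mul' _ _ ENNReal.ofReal_ne_top]
    refine lintegral_mono fun x => ?_
    have := tail_le_lintegral_orliczKernel (p := p) hp hq hs x
    rwa [abs_mul, abs_of_pos hs, hs', ← abs_mul] at this
  refine hmono.trans ((mul_le_mul_right hle _).trans (le_of_eq ?_))
  rw [← ENNReal.ofReal_mul (by positivity), ← ENNReal.ofReal_mul' (orliczFun_nonneg hp hμ hs.le)]
  congr 1
  field_simp

end OrliczFun

/-! ### Truncated moments of the Pareto-type law. -/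

section Pareto

theorem lintegral_Ici_rpow {a c : ℝ} (ha : a < -1) (hc : 0 < c) :
    ∫⁻ x in Set.Ici c, ENNReal.ofReal (x ^ a) = ENNReal.ofReal (-c ^ (a + 1) / (a + 1)) := by
  rw [← setLIntegral_congr Ioi_ae_eq_Ici, ← integral_Ioi_rpow_of_lt ha hc,
    ofReal_integral_eq_lintegral_ofReal (integrableOn_Ioi_rpow_of_lt ha hc)]
  filter_upwards [ae_restrict_mem measurableSet_Ioi] with x hx
  exact Real.rpow_nonneg (hc.trans hx).le _

theorem lintegral_Ioc_rpow {a c : ℝ} (ha : -1 < a) (hc : 0 ≤ c) :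
    ∫⁻ x in Set.Ioc 0 c, ENNReal.ofReal (x ^ a) = ENNReal.ofReal (c ^ (a + 1) / (a + 1)) := by
  have h := integral_rpow (a := 0) (b := c) (r := a) (Or.inl ha)
  rw [intervalIntegral.integral_of_le hc, Real.zero_rpow (by linarith), sub_zero] at h
  rw [← h, ofReal_integral_eq_lintegral_ofReal
    ((intervalIntegrable_iff_integrableOn_Ioc_of_le hc).1
      (intervalIntegral.intervalIntegrable_rpow' ha))]
  filter_upwards [ae_restrict_mem measurableSet_Ioc] with x hx
  exact Real.rpow_nonneg hx.1.le _

variable {q : ℝ}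

theorem measurable_paretoTypeDensity : Measurable (paretoTypeDensity q) :=
  (by fun_prop : Measurable fun x : ℝ => q * (q - 1) * x ^ (-q - 1)).indicator measurableSet_Ici

theorem lintegral_paretoTypeLaw {f : ℝ → ℝ≥0∞} (hf : Measurable f) :
    ∫⁻ x, f x ∂(paretoTypeLaw q) =
      ∫⁻ x, ENNReal.ofReal (paretoTypeDensity q x) * f x := by
  rw [paretoTypeLaw, lintegral_withDensity_eq_lintegral_mul _
    measurable_paretoTypeDensity.ennreal_ofReal hf]
  rfl

theorem paretoThreshold_pos (hq : 1 < q) : 0 < (q - 1) ^ (1 / q) :=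
  Real.rpow_pos_of_pos (by linarith) _

theorem paretoThreshold_rpow (hq : 1 < q) : ((q - 1) ^ (1 / q)) ^ q = q - 1 := by
  rw [one_div, Real.rpow_inv_rpow (by linarith) (by linarith)]

theorem isProbabilityMeasure_paretoTypeLaw (hq : 1 < q) :
    IsProbabilityMeasure (paretoTypeLaw q) := by
  have h1 : 0 < q - 1 := by linarith
  have hκ := paretoThreshold_pos hq
  refine ⟨?_⟩
  rw [← lintegral_one, lintegral_paretoTypeLaw measurable_const]
  have e : ∀ x : ℝ, ENNReal.ofReal (paretoTypeDensity q x) * 1 =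
      (Set.Ici ((q - 1) ^ (1 / q))).indicator
        (fun x => ENNReal.ofReal (q * (q - 1)) * ENNReal.ofReal (x ^ (-q - 1))) x := fun x => by
    rw [paretoTypeDensity, mul_one]
    by_cases hx : x ∈ Set.Ici ((q - 1) ^ (1 / q))
    · rw [Set.indicator_of_mem hx, Set.indicator_of_mem hx, ENNReal.ofReal_mul (by positivity)]
    · rw [Set.indicator_of_notMem hx, Set.indicator_of_notMem hx, ENNReal.ofReal_zero]
  simp_rw [e]
  rw [lintegral_indicator measurableSet_Ici, lintegral_const_mul _ (by fun_prop),
    lintegral_Ici_rpow (by linarith) hκ, ← ENNReal.ofReal_mul (by positivity), sub_add_cancel,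
    Real.rpow_neg hκ.le, paretoThreshold_rpow hq, ENNReal.ofReal_eq_one]
  field_simp

theorem lintegral_paretoTail (hq : 1 < q) {s : ℝ} (hs : 0 < s) :
    ∫⁻ x, (Set.Ici (1 / s)).indicator
      (fun x => ENNReal.ofReal (q * (q - 1) * s) * ENNReal.ofReal (x ^ (-q))) x =
      ENNReal.ofReal (q * s ^ q) := by
  have h1 : 0 < q - 1 := by linarith
  rw [lintegral_indicator measurableSet_Ici, lintegral_const_mul _ (by fun_prop),
    lintegral_Ici_rpow (by linarith) (by positivity), ← ENNReal.ofReal_mul (by positivity)]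
  congr 1
  rw [one_div, Real.inv_rpow hs.le, ← Real.rpow_neg hs.le, neg_add, neg_neg, Real.rpow_add hs,
    Real.rpow_neg_one]
  have : -q + 1 ≠ 0 := by linarith
  field_simp
  ring

theorem measurable_ite_lt {f g : ℝ → ℝ} (hf : Measurable f) (hg : Measurable g) (s c : ℝ) :
    Measurable fun x : ℝ => ENNReal.ofReal (if |s * x| < c then f |s * x| else g |s * x|) :=
  (Measurable.ite (measurableSet_lt (by fun_prop) measurable_const) (hf.comp (by fun_prop))
    (hg.comp (by fun_prop))).ennreal_ofReal

theorem lintegral_pareto_large_le (hq : 1 < q) {s : ℝ} (hs : 0 ≤ s) :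
    ∫⁻ x, ENNReal.ofReal (if |s * x| < 1 then 0 else |s * x|) ∂(paretoTypeLaw q) ≤
      ENNReal.ofReal (q * s ^ q) := by
  rcases hs.eq_or_lt with rfl | hs
  · simp
  have h1 : 0 < q - 1 := by linarith
  rw [lintegral_paretoTypeLaw (measurable_ite_lt (f := fun _ => 0) (g := fun y => y) measurable_const
      measurable_id s 1),
    ← lintegral_paretoTail hq hs]
  refine lintegral_mono fun x => ?_
  by_cases hx : x ∈ Set.Ici ((q - 1) ^ (1 / q))
  · have hx0 : 0 < x := (paretoThreshold_pos hq).trans_le hx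
    split_ifs with h
    · simp
    · rw [abs_of_pos (by positivity), not_lt] at h
      rw [paretoTypeDensity, Set.indicator_of_mem hx, Set.indicator_of_mem
        (by rw [Set.mem_Ici, div_le_iff₀ hs]; linarith), ← ENNReal.ofReal_mul (by positivity),
        ← ENNReal.ofReal_mul (by positivity), abs_of_pos (by positivity),
        Real.rpow_sub_one hx0.ne']
      refine ENNReal.ofReal_le_ofReal (le_of_eq ?_)
      field_simp
  · rw [paretoTypeDensity, Set.indicator_of_notMem hx]
    simp

/-- The condition `s * (q - 1) ^ (1 / q) ≤ 1` places the whole half-line `x ≥ 1 / s` inside the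
support, so the tail integral is not cut off. -/
theorem le_lintegral_pareto_large (hq : 1 < q) {s : ℝ} (hs : 0 ≤ s)
    (hsκ : s * (q - 1) ^ (1 / q) ≤ 1) :
    ENNReal.ofReal (q * s ^ q) ≤
      ∫⁻ x, ENNReal.ofReal (if 1 < |s * x| then |s * x| else 0) ∂(paretoTypeLaw q) := by
  rcases hs.eq_or_lt with rfl | hs
  · simp [Real.zero_rpow (by linarith : q ≠ 0)]
  have h1 : 0 < q - 1 := by linarith
  have hm : Measurable fun x : ℝ => ENNReal.ofReal (if 1 < |s * x| then |s * x| else 0) :=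
    (Measurable.ite (measurableSet_lt measurable_const (by fun_prop)) (by fun_prop)
      measurable_const).ennreal_ofReal
  rw [lintegral_paretoTypeLaw hm, ← lintegral_paretoTail hq hs]
  have hae : ∀ᵐ x : ℝ, x ≠ 1 / s := by simp [ae_iff]
  refine lintegral_mono_ae ?_
  filter_upwards [hae] with x hx
  by_cases hxs : x ∈ Set.Ici (1 / s)
  · have hlt : 1 / s < x := lt_of_le_of_ne hxs hx.symm
    have hx0 : 0 < x := lt_trans (by positivity) hlt
    have hxκ : x ∈ Set.Ici ((q - 1) ^ (1 / q)) := by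
      refine le_trans ?_ hlt.le
      rw [le_div_iff₀ hs]
      linarith
    have hsx : 1 < s * x := by rwa [div_lt_iff₀ hs, mul_comm] at hlt
    rw [paretoTypeDensity, Set.indicator_of_mem hxs, Set.indicator_of_mem hxκ,
      abs_of_pos (by positivity), if_pos hsx, ← ENNReal.ofReal_mul (by positivity),
      ← ENNReal.ofReal_mul (by positivity), Real.rpow_sub_one hx0.ne']
    refine ENNReal.ofReal_le_ofReal (le_of_eq ?_)
    field_simp
  · rw [Set.indicator_of_notMem hxs]
    exact zero_le

/-- The constant `q (q - 1) / (p - q)`, read as `0` for `p = ∞`. -/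
noncomputable def paretoSmallConst (p : ℝ≥0∞) (q : ℝ) : ℝ :=
  if p = ∞ then 0 else q * (q - 1) / (p.toReal - q)

theorem lt_toReal_of_ofReal_lt {p : ℝ≥0∞} (hq : 1 < q) (hqp : ENNReal.ofReal q < p)
    (hp' : p ≠ ∞) : q < p.toReal :=
  (ENNReal.ofReal_lt_iff_lt_toReal (by linarith) hp').1 hqp

theorem paretoSmallConst_nonneg {p : ℝ≥0∞} (hq : 1 < q) (hqp : ENNReal.ofReal q < p) :
    0 ≤ paretoSmallConst p q := by
  unfold paretoSmallConst
  split_ifs with h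
  · exact le_rfl
  · have h1 : 0 < q - 1 := by linarith
    have h2 : 0 < p.toReal - q := sub_pos.2 (lt_toReal_of_ofReal_lt hq hqp h)
    positivity

/-- Extending the density down to `0` leaves `x ^ (p - q - 1)`, integrable at the origin exactly
because `q < p`. -/
theorem lintegral_pareto_small_le {p : ℝ≥0∞} (hq : 1 < q) (hqp : ENNReal.ofReal q < p) {s : ℝ}
    (hs : 0 ≤ s) :
    ∫⁻ x, ENNReal.ofReal (if |s * x| < 1 then powCost p |s * x| else 0) ∂(paretoTypeLaw q) ≤
      ENNReal.ofReal (paretoSmallConst p q * s ^ q) := by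
  by_cases hp' : p = ∞
  · simp [powCost, hp']
  have hpq := lt_toReal_of_ofReal_lt hq hqp hp'
  rcases hs.eq_or_lt with rfl | hs
  · simp [powCost, hp', Real.zero_rpow (by linarith : p.toReal ≠ 0)]
  have h1 : 0 < q - 1 := by linarith
  rw [lintegral_paretoTypeLaw (measurable_ite_lt (measurable_powCost p) measurable_const s 1)]
  have hval : ∫⁻ x, (Set.Ioc 0 (1 / s)).indicator (fun x => ENNReal.ofReal
      (q * (q - 1) * s ^ p.toReal) * ENNReal.ofReal (x ^ (p.toReal - q - 1))) x =
      ENNReal.ofReal (paretoSmallConst p q * s ^ q) := by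
    rw [lintegral_indicator measurableSet_Ioc, lintegral_const_mul _ (by fun_prop),
      lintegral_Ioc_rpow (by linarith) (by positivity), ← ENNReal.ofReal_mul (by positivity)]
    congr 1
    rw [one_div, Real.inv_rpow hs.le, sub_add_cancel, Real.rpow_sub hs, paretoSmallConst,
      if_neg hp']
    have : p.toReal - q ≠ 0 := by linarith
    field_simp
  rw [← hval]
  refine lintegral_mono fun x => ?_
  by_cases hx : x ∈ Set.Ici ((q - 1) ^ (1 / q))
  · have hx0 : 0 < x := (paretoThreshold_pos hq).trans_le hx
    split_ifs with h
    · rw [abs_of_pos (by positivity)] at h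
      rw [paretoTypeDensity, Set.indicator_of_mem hx, Set.indicator_of_mem
        (by rw [Set.mem_Ioc, le_div_iff₀ hs]; exact ⟨hx0, by linarith⟩),
        ← ENNReal.ofReal_mul (by positivity), ← ENNReal.ofReal_mul (by positivity),
        abs_of_pos (by positivity), powCost, if_neg hp', Real.mul_rpow hs.le hx0.le]
      refine ENNReal.ofReal_le_ofReal (le_of_eq ?_)
      have : x ^ (p.toReal - q - 1) = x ^ (-q - 1) * x ^ p.toReal := by
        rw [← Real.rpow_add hx0]
        congr 1; ring
      rw [this]
      ring
    · simp
  · rw [paretoTypeDensity, Set.indicator_of_notMem hx]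
    simp

end Pareto

/-! ### Averaging over the Pareto variables: from `ℓ_p` to `ℓ_q`. -/

section Vectors

variable {ι : Type*} [Fintype ι]

theorem lintegral_pi_eval (μ : Measure ℝ) [IsProbabilityMeasure μ] {f : ℝ → ℝ≥0∞}
    (hf : Measurable f) (i : ι) :
    ∫⁻ x, f (x i) ∂(Measure.pi fun _ : ι => μ) = ∫⁻ y, f y ∂μ :=
  (measurePreserving_eval (fun _ : ι => μ) i).lintegral_comp hf

theorem iIndepFun_pi_mul (μ : Measure ℝ) [IsProbabilityMeasure μ] (b : ι → ℝ) :
    iIndepFun (fun i (x : ι → ℝ) => b i * x i) (Measure.pi fun _ : ι => μ) :=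
  iIndepFun_pi (μ := fun _ : ι => μ) (X := fun i y => b i * y) fun i => by fun_prop

theorem ellNorm_mul_eq {p : ℝ≥0∞} (hp : 1 ≤ p) {t : ℝ} (ht : 0 < t) (b x : ι → ℝ) :
    ellNorm p (fun i => b i * x i) = t * ellNorm p fun i => b i / t * x i := by
  conv_rhs => rw [← abs_of_pos ht, ← ellNorm_smul hp]
  congr 1
  ext i
  field_simp
  rw [abs_of_pos ht]

theorem lintegral_ellNorm_mul {p : ℝ≥0∞} (hp : 1 ≤ p) {t r : ℝ} (ht : 0 < t) (b : ι → ℝ)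
    (μ : Measure (ι → ℝ)) :
    ∫⁻ x, ENNReal.ofReal (ellNorm p (fun i => b i * x i) ^ r) ∂μ =
      ENNReal.ofReal (t ^ r) *
        ∫⁻ x, ENNReal.ofReal (ellNorm p (fun i => b i / t * x i) ^ r) ∂μ := by
  rw [← lintegral_const_mul' _ _ ENNReal.ofReal_ne_top]
  refine lintegral_congr fun x => ?_
  rw [ellNorm_mul_eq hp ht, Real.mul_rpow ht.le (ellNorm_nonneg hp _),
    ENNReal.ofReal_mul (by positivity)]

variable {p : ℝ≥0∞} {q : ℝ}

theorem one_lt_of_ofReal_lt (hq : 1 < q) (hqp : ENNReal.ofReal q < p) : 1 < p :=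
  lt_trans (by simpa using hq) hqp

theorem ellNorm_eq_zero_iff {r : ℝ≥0∞} (hr : 1 ≤ r) {b : ι → ℝ} :
    ellNorm r b = 0 ↔ b = 0 := by
  have : Fact (1 ≤ r) := ⟨hr⟩
  rw [ellNorm, norm_eq_zero]
  simp

theorem sum_rpow_div_ellNorm (hq : 1 < q) {b : ι → ℝ}
    (hb : 0 < ellNorm (ENNReal.ofReal q) b) :
    ∑ i, |b i / ellNorm (ENNReal.ofReal q) b| ^ q = 1 := by
  have h := ellNorm_rpow (p := ENNReal.ofReal q) (by simpa using hq.le) ENNReal.ofReal_ne_top b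
  rw [ENNReal.toReal_ofReal (by linarith)] at h
  simp only [abs_div, abs_of_pos hb]
  simp only [Real.div_rpow (abs_nonneg _) hb.le]
  rw [← Finset.sum_div, ← h, div_self (by positivity)]

/-- The constant in the upper bound for the `ℓ_p`-norm of a weighted Pareto vector. -/
noncomputable def paretoUpperConst (p : ℝ≥0∞) (q : ℝ) : ℝ := 1 + (paretoSmallConst p q + q)

/-- By homogeneity `‖b‖_q = 1`; then the truncated moments of the entries are bounded by multiples
of `|b i| ^ q`, which sum to a constant. -/
theorem lintegral_pareto_ellNorm_le (hq : 1 < q) (hqp : ENNReal.ofReal q < p) (b : ι → ℝ) :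
    ∫⁻ x, ENNReal.ofReal (ellNorm p fun i => b i * x i)
        ∂(Measure.pi fun _ : ι => paretoTypeLaw q) ≤
      ENNReal.ofReal (paretoUpperConst p q * ellNorm (ENNReal.ofReal q) b) := by
  have := isProbabilityMeasure_paretoTypeLaw hq
  have hp := one_lt_of_ofReal_lt hq hqp
  have hq1 : 1 ≤ ENNReal.ofReal q := by simpa using hq.le
  have hA := paretoSmallConst_nonneg hq hqp
  set N := ellNorm (ENNReal.ofReal q) b with hN
  rcases (ellNorm_nonneg hq1 b).eq_or_lt with h0 | hpos
  · have hb : b = 0 := (ellNorm_eq_zero_iff hq1).1 h0.symm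
    have : ellNorm p (0 : ι → ℝ) = 0 := (ellNorm_eq_zero_iff hp.le).2 rfl
    simp only [hb, Pi.zero_apply, zero_mul]
    change ∫⁻ _, ENNReal.ofReal (ellNorm p (0 : ι → ℝ)) ∂_ ≤ _
    simp [this]
  have hs := lintegral_ellNorm_mul hp.le (r := 1) hpos b
    (Measure.pi fun _ : ι => paretoTypeLaw q)
  simp only [Real.rpow_one] at hs
  rw [hs, mul_comm (paretoUpperConst p q), ENNReal.ofReal_mul hpos.le]
  refine mul_le_mul_right ?_ _
  have hup := lintegral_ellNorm_rpow_le (P := Measure.pi fun _ : ι => paretoTypeLaw q) hp.le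
    (r := 1) (θ := 1) le_rfl (by simpa using hp.le) le_rfl
    (Y := fun i x => b i / N * x i) fun i => by fun_prop
  simp only [Real.rpow_one] at hup
  refine hup.trans ?_
  have hterm : ∀ i, ∫⁻ x, ENNReal.ofReal (if |b i / N * x i| < 1 then powCost p |b i / N * x i|
      else 0) ∂(Measure.pi fun _ : ι => paretoTypeLaw q) +
      ∫⁻ x, ENNReal.ofReal (if |b i / N * x i| < 1 then 0 else |b i / N * x i|)
        ∂(Measure.pi fun _ : ι => paretoTypeLaw q) ≤
      ENNReal.ofReal ((paretoSmallConst p q + q) * |b i / N| ^ q) := fun i => by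
    have e1 := lintegral_pi_eval (paretoTypeLaw q)
      (measurable_ite_lt (measurable_powCost p) (measurable_const (a := 0)) (b i / N) 1) i
    have e2 := lintegral_pi_eval (paretoTypeLaw q)
      (measurable_ite_lt (measurable_const (a := 0)) (g := fun y => y) measurable_id (b i / N) 1) i
    rw [e1, e2, add_mul, ENNReal.ofReal_add (by positivity) (by positivity)]
    have h1 := lintegral_pareto_small_le hq hqp (abs_nonneg (b i / N))
    have h2 := lintegral_pareto_large_le hq (abs_nonneg (b i / N))
    simp only [abs_mul, abs_abs] at h1 h2 ⊢
    exact add_le_add h1 h2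
  refine (add_le_add_right (Finset.sum_le_sum fun i _ => hterm i) _).trans (le_of_eq ?_)
  rw [← ENNReal.ofReal_sum_of_nonneg fun i _ => by positivity, ← Finset.mul_sum,
    sum_rpow_div_ellNorm hq hpos, mul_one, ← ENNReal.ofReal_add zero_le_one (by positivity)]
  rfl

theorem le_lintegral_pareto_ellNorm (hq : 1 < q) (hp : 1 ≤ p) (b : ι → ℝ) :
    ENNReal.ofReal ((q - 1) ^ (1 / q) / 2 * ellNorm (ENNReal.ofReal q) b) ≤
      ∫⁻ x, ENNReal.ofReal (ellNorm p fun i => b i * x i)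
        ∂(Measure.pi fun _ : ι => paretoTypeLaw q) := by
  have := isProbabilityMeasure_paretoTypeLaw hq
  have hq1 : 1 ≤ ENNReal.ofReal q := by simpa using hq.le
  have hq0 : 0 < q - 1 := by linarith
  have hκ := paretoThreshold_pos hq
  set κ := (q - 1) ^ (1 / q) with hκ'
  set N := ellNorm (ENNReal.ofReal q) b with hN
  rcases (ellNorm_nonneg hq1 b).eq_or_lt with h0 | hpos
  · rw [hN, ← h0]
    simp
  -- Normalising by `κ * N` instead of `N` makes every coefficient at most `1 / κ`, as the tail
  -- bound requires. The tail means then sum to at least `q / κ ^ q = q / (q - 1) ≥ 1`.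
  have hs := lintegral_ellNorm_mul hp (r := 1) (mul_pos hκ hpos) b
    (Measure.pi fun _ : ι => paretoTypeLaw q)
  simp only [Real.rpow_one] at hs
  rw [hs, (by ring : κ / 2 * N = κ * N * (1 / 2)), ENNReal.ofReal_mul (by positivity)]
  refine mul_le_mul_right ?_ _
  have hlow := min_le_lintegral_ellNorm (p := p) hp
    (Y := fun i (x : ι → ℝ) => b i / (κ * N) * x i) (fun i => by fun_prop)
    (iIndepFun_pi_mul (paretoTypeLaw q) fun i => b i / (κ * N))
  refine le_trans ?_ hlow
  have half : ENNReal.ofReal (1 / 2) = 1 / 2 := by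
    rw [ENNReal.ofReal_div_of_pos two_pos]; simp
  rw [half]
  refine le_min le_rfl ?_
  have hterm : ∀ i, ENNReal.ofReal (q / (q - 1) * |b i / N| ^ q) ≤
      ∫⁻ x, ENNReal.ofReal (if 1 < |b i / (κ * N) * x i| then |b i / (κ * N) * x i| else 0)
        ∂(Measure.pi fun _ : ι => paretoTypeLaw q) := fun i => by
    have hm : Measurable fun y : ℝ => ENNReal.ofReal
        (if 1 < |b i / (κ * N) * y| then |b i / (κ * N) * y| else 0) :=
      (Measurable.ite (measurableSet_lt measurable_const (by fun_prop)) (by fun_prop)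
        measurable_const).ennreal_ofReal
    rw [lintegral_pi_eval (paretoTypeLaw q) hm i]
    have hb := abs_le_ellNorm hq1 b i
    have h2 := le_lintegral_pareto_large hq (abs_nonneg (b i / (κ * N))) (by
      rw [abs_div, abs_of_pos (by positivity : 0 < κ * N), ← hκ']
      have : |b i| / (κ * N) * κ = |b i| / N := by field_simp
      rw [this, div_le_one hpos]
      exact hb)
    simp only [abs_mul, abs_abs] at h2 ⊢
    refine le_trans (le_of_eq ?_) h2
    congr 1
    rw [abs_div, abs_div, abs_of_pos hpos, abs_of_pos (by positivity : 0 < κ * N),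
      Real.div_rpow (abs_nonneg _) hpos.le, Real.div_rpow (abs_nonneg _) (by positivity),
      Real.mul_rpow hκ.le hpos.le, hκ', paretoThreshold_rpow hq]
    field_simp
  have hsum : 1 ≤ ∑ i, ∫⁻ x, ENNReal.ofReal
      (if 1 < |b i / (κ * N) * x i| then |b i / (κ * N) * x i| else 0)
        ∂(Measure.pi fun _ : ι => paretoTypeLaw q) := by
    refine le_trans ?_ (Finset.sum_le_sum fun i _ => hterm i)
    rw [← ENNReal.ofReal_sum_of_nonneg fun i _ => by positivity, ← Finset.mul_sum,
      sum_rpow_div_ellNorm hq hpos, mul_one, ENNReal.one_le_ofReal, one_le_div hq0]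
    linarith
  calc (1 / 2 : ℝ≥0∞) = 1 / 2 * 1 := (mul_one _).symm
    _ ≤ _ := mul_le_mul_right hsum _

end Vectors

/-! ### Averaging over `X`: moments of one row and the Luxemburg norm. -/

section Rows

variable {n : ℕ} {p : ℝ≥0∞} {q C : ℝ} {μ : Measure ℝ} [IsProbabilityMeasure μ]

/-- The constant in the upper bound for the `q`-th moment of a row norm. -/
noncomputable def rowUpperConst (p : ℝ≥0∞) (q C : ℝ) : ℝ :=
  2 ^ q + (kernelConst p + 2 ^ (q + 3) * C)

theorem rowUpperConst_pos (hp : 1 < p) (hC : 0 < C) : 0 < rowUpperConst p q C := by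
  have := kernelConst_pos hp
  unfold rowUpperConst
  positivity

theorem lintegral_row_rpow_le_of_sum_le (hq : 1 < q) (hqp : ENNReal.ofReal q < p) (hC : 0 < C)
    (hμ : Integrable id μ) (hI : IntegralCondition (orliczFun μ id p) q C) {a : Fin n → ℝ}
    (ha : ∑ j, orliczFun μ id p |a j| ≤ 1) :
    ∫⁻ x, ENNReal.ofReal (ellNorm p (fun j => a j * x j) ^ q)
      ∂(Measure.pi fun _ : Fin n => μ) ≤ ENNReal.ofReal (rowUpperConst p q C) := by
  have hp := one_lt_of_ofReal_lt hq hqp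
  have hK := kernelConst_pos hp
  have hM : ∀ j, 0 ≤ orliczFun μ id p |a j| := fun j => orliczFun_nonneg hp hμ (abs_nonneg _)
  have hM1 : ∀ j, orliczFun μ id p |a j| ≤ 1 := fun j =>
    (Finset.single_le_sum (fun j _ => hM j) (Finset.mem_univ j)).trans ha
  refine (lintegral_ellNorm_rpow_le (P := Measure.pi fun _ : Fin n => μ) hp.le hq.le hqp.le
    (θ := 2) (by norm_num) (Y := fun j x => a j * x j) fun j => by fun_prop).trans ?_
  have hterm : ∀ j, ∫⁻ x, ENNReal.ofReal (if |a j * x j| < 2 then powCost p |a j * x j|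
      else 0) ∂(Measure.pi fun _ : Fin n => μ) +
      ∫⁻ x, ENNReal.ofReal (if |a j * x j| < 2 then 0 else |a j * x j| ^ q)
        ∂(Measure.pi fun _ : Fin n => μ) ≤
      ENNReal.ofReal ((kernelConst p + 2 ^ (q + 3) * C) * orliczFun μ id p |a j|) := fun j => by
    have e1 := lintegral_pi_eval μ
      (measurable_ite_lt (measurable_powCost p) (measurable_const (a := 0)) (a j) 2) j
    have e2 := lintegral_pi_eval μ
      (measurable_ite_lt (measurable_const (a := 0)) (g := fun y => y ^ q) (by fun_prop) (a j) 2) j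
    have := hM j
    rw [e1, e2, add_mul, ENNReal.ofReal_add (by positivity) (by positivity),
      ENNReal.ofReal_mul hK.le, ENNReal.ofReal_mul (by positivity)]
    exact add_le_add (lintegral_powCost_le hp hμ (a j)) (lintegral_tail_le hp hq hμ hI _ (hM1 j))
  refine (add_le_add_right (Finset.sum_le_sum fun j _ => hterm j) _).trans ?_
  rw [← ENNReal.ofReal_sum_of_nonneg fun j _ => mul_nonneg (by positivity) (hM j),
    ← Finset.mul_sum, ← ENNReal.ofReal_add (by positivity)
      (mul_nonneg (by positivity) (Finset.sum_nonneg fun j _ => hM j))]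
  refine ENNReal.ofReal_le_ofReal (add_le_add_right ?_ _)
  exact mul_le_of_le_one_right (by positivity) ha

theorem luxemburgNorm_nonneg (M : ℝ → ℝ) (a : Fin n → ℝ) : 0 ≤ luxemburgNorm M a :=
  Real.sInf_nonneg fun _ ht => ht.1.le

theorem exists_sum_orliczFun_le_one (hq : 1 < q) (hqp : ENNReal.ofReal q < p)
    (hμ : Integrable id μ) (hμq : Integrable (fun x => |x| ^ q) μ) (a : Fin n → ℝ) :
    ∃ t : ℝ, 0 < t ∧ ∑ j, orliczFun μ id p (|a j| / t) ≤ 1 := by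
  have hp := one_lt_of_ofReal_lt hq hqp
  set B := conjFactor p * ∫ x, |x| ^ q ∂μ with hB
  have hB0 : 0 ≤ B := mul_nonneg (conjFactor_pos hp).le (integral_nonneg fun x => by positivity)
  have hlim : Tendsto (fun t : ℝ => ∑ j, B * (|a j| ^ q * t ^ (-q))) atTop
      (𝓝 (∑ j : Fin n, B * (|a j| ^ q * 0))) :=
    tendsto_finsetSum _ fun j _ =>
      ((tendsto_rpow_neg_atTop (by linarith)).const_mul _).const_mul _
  simp only [mul_zero, Finset.sum_const_zero] at hlim
  obtain ⟨t, ht, ht0⟩ :=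
    ((hlim.eventually (gt_mem_nhds zero_lt_one)).and (eventually_gt_atTop 0)).exists
  refine ⟨t, ht0, le_trans (Finset.sum_le_sum fun j _ => ?_) ht.le⟩
  refine (orliczFun_le_rpow hp hq.le hqp.le hμ hμq (by positivity)).trans (le_of_eq ?_)
  rw [Real.div_rpow (abs_nonneg _) ht0.le, Real.rpow_neg ht0.le, div_eq_mul_inv]

/-- Any `t` above the norm exceeds some admissible `s`; scaling by `s` reduces to the normalised
row, and `t` then decreases to the norm. Monotonicity of `M` and attainment of the infimum are not
needed, and a zero norm is covered. -/
theorem lintegral_row_rpow_le (hq : 1 < q) (hqp : ENNReal.ofReal q < p) (hC : 0 < C)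
    (hμ : Integrable id μ) (hμq : Integrable (fun x => |x| ^ q) μ)
    (hI : IntegralCondition (orliczFun μ id p) q C) (a : Fin n → ℝ) :
    ∫⁻ x, ENNReal.ofReal (ellNorm p (fun j => a j * x j) ^ q)
      ∂(Measure.pi fun _ : Fin n => μ) ≤
      ENNReal.ofReal (luxemburgNorm (orliczFun μ id p) a ^ q * rowUpperConst p q C) := by
  have hp := one_lt_of_ofReal_lt hq hqp
  have hN0 := luxemburgNorm_nonneg (orliczFun μ id p) a
  set N := luxemburgNorm (orliczFun μ id p) a with hN
  have hle : ∀ t, N < t → ∫⁻ x, ENNReal.ofReal (ellNorm p (fun j => a j * x j) ^ q)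
      ∂(Measure.pi fun _ : Fin n => μ) ≤ ENNReal.ofReal (t ^ q * rowUpperConst p q C) := by
    intro t ht
    obtain ⟨s, ⟨hs0, hs1⟩, hst⟩ := exists_lt_of_csInf_lt
      (exists_sum_orliczFun_le_one hq hqp hμ hμq a) ht
    rw [lintegral_ellNorm_mul hp.le hs0, ENNReal.ofReal_mul (Real.rpow_nonneg (hN0.trans ht.le) _)]
    refine mul_le_mul' (ENNReal.ofReal_le_ofReal
      (Real.rpow_le_rpow hs0.le hst.le (by linarith))) ?_
    refine lintegral_row_rpow_le_of_sum_le hq hqp hC hμ hI ?_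
    simpa only [abs_div, abs_of_pos hs0] using hs1
  have hcont : Continuous fun t : ℝ => ENNReal.ofReal (t ^ q * rowUpperConst p q C) :=
    ENNReal.continuous_ofReal.comp ((Real.continuous_rpow_const (by linarith)).mul_const _)
  refine ge_of_tendsto ((hcont.tendsto N).mono_left (nhdsWithin_le_nhds (s := Set.Ioi N))) ?_
  filter_upwards [self_mem_nhdsWithin] with t ht
  exact hle t ht

/-- A positive `t` below the norm is not admissible, so `∑ M(|a j| / t) > 1`. As `M` is at most
`conjFactor p` times the truncated means, these sum to at least `1 / conjFactor p`. -/
theorem le_lintegral_row (hp : 1 < p) (hμ : Integrable id μ) (a : Fin n → ℝ) :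
    ENNReal.ofReal (luxemburgNorm (orliczFun μ id p) a * ellLowerConst (conjFactor p)) ≤
      ∫⁻ x, ENNReal.ofReal (ellNorm p fun j => a j * x j) ∂(Measure.pi fun _ : Fin n => μ) := by
  have hL := conjFactor_pos hp
  set N := luxemburgNorm (orliczFun μ id p) a with hN
  have hle : ∀ t, 0 < t → t < N → ENNReal.ofReal (t * ellLowerConst (conjFactor p)) ≤
      ∫⁻ x, ENNReal.ofReal (ellNorm p fun j => a j * x j) ∂(Measure.pi fun _ : Fin n => μ) := by
    intro t ht0 ht
    have hsum : 1 < ∑ j, orliczFun μ id p |a j / t| := by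
      by_contra! h
      simp only [abs_div, abs_of_pos ht0] at h
      have hmem : t ∈ {t : ℝ | 0 < t ∧ ∑ j, orliczFun μ id p (|a j| / t) ≤ 1} := ⟨ht0, h⟩
      exact (csInf_le ⟨0, fun s hs => hs.1.le⟩ hmem).not_gt ht
    have hs := lintegral_ellNorm_mul hp.le (r := 1) ht0 a (Measure.pi fun _ : Fin n => μ)
    simp only [Real.rpow_one] at hs
    rw [hs, ENNReal.ofReal_mul ht0.le]
    refine mul_le_mul_right ?_ _
    have hind : iIndepFun (fun j (x : Fin n → ℝ) => a j / t * x j)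
        (Measure.pi fun _ : Fin n => μ) := iIndepFun_pi_mul μ fun j => a j / t
    have hmeas : ∀ j, Measurable fun x : Fin n → ℝ => a j / t * x j := fun j => by fun_prop
    refine le_lintegral_ellNorm hp.le hL hmeas hind ?_
    have hterm : ∀ j, ∫⁻ x, ENNReal.ofReal (if |a j / t * x j| ≤ 1 then powCost p |a j / t * x j|
        else 0) ∂(Measure.pi fun _ : Fin n => μ) +
        ∫⁻ x, ENNReal.ofReal (if 1 < |a j / t * x j| then |a j / t * x j| else 0)
          ∂(Measure.pi fun _ : Fin n => μ) =
        ∫⁻ x, ENNReal.ofReal (if |a j / t * x| ≤ 1 then powCost p |a j / t * x| else 0) ∂μ +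
        ∫⁻ x, ENNReal.ofReal (if 1 < |a j / t * x| then |a j / t * x| else 0) ∂μ := fun j => by
      have hm : Measurable fun x : ℝ => ENNReal.ofReal
          (if |a j / t * x| ≤ 1 then powCost p |a j / t * x| else 0) :=
        (Measurable.ite (measurableSet_le (by fun_prop) measurable_const)
          ((measurable_powCost p).comp (by fun_prop)) measurable_const).ennreal_ofReal
      have hm' : Measurable fun x : ℝ => ENNReal.ofReal
          (if 1 < |a j / t * x| then |a j / t * x| else 0) :=
        (Measurable.ite (measurableSet_lt measurable_const (by fun_prop)) (by fun_prop)
          measurable_const).ennreal_ofReal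
      rw [lintegral_pi_eval μ hm j, lintegral_pi_eval μ hm' j]
    simp only [hterm]
    rw [ENNReal.ofReal_div_of_pos hL, ENNReal.ofReal_one]
    refine ENNReal.div_le_of_le_mul' ?_
    rw [Finset.mul_sum]
    refine le_trans ?_ (Finset.sum_le_sum fun j _ => ofReal_orliczFun_le hp hμ (a j / t))
    rw [← ENNReal.ofReal_sum_of_nonneg fun j _ => orliczFun_nonneg hp hμ (abs_nonneg _)]
    exact ENNReal.one_le_ofReal.2 hsum.le
  rcases (luxemburgNorm_nonneg (orliczFun μ id p) a).eq_or_lt with h0 | hpos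
  · rw [hN, ← h0]
    simp
  have hcont : Continuous fun t : ℝ => ENNReal.ofReal (t * ellLowerConst (conjFactor p)) :=
    ENNReal.continuous_ofReal.comp (by fun_prop)
  refine le_of_tendsto ((hcont.tendsto N).mono_left (nhdsWithin_le_nhds (s := Set.Iio N))) ?_
  filter_upwards [self_mem_nhdsWithin, mem_nhdsWithin_of_mem_nhds (lt_mem_nhds hpos)] with t ht ht0
  exact hle t ht0 ht

end Rows

/-! ### Exchanging the expectation with an outer `ℓ_q`-norm. -/

section Mixed

variable {ι : Type*} [Fintype ι] {Ω : Type*} [MeasurableSpace Ω] {P : Measure Ω}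

theorem lintegral_ofReal_ellNorm_le [IsProbabilityMeasure P] {q : ℝ} (hq : 1 < q)
    {b : ι → Ω → ℝ} (hb : ∀ i, Measurable (b i)) :
    ∫⁻ ω, ENNReal.ofReal (ellNorm (ENNReal.ofReal q) fun i => b i ω) ∂P ≤
      (∑ i, ∫⁻ ω, ENNReal.ofReal (|b i ω| ^ q) ∂P) ^ (1 / q) := by
  have hq0 : 0 < q := by linarith
  have hq1 : 1 ≤ ENNReal.ofReal q := by simpa using hq.le
  have hm : Measurable fun ω => ENNReal.ofReal (ellNorm (ENNReal.ofReal q) fun i => b i ω) :=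
    ((measurable_ellNorm hq1).comp (measurable_pi_lambda _ hb)).ennreal_ofReal
  have h := eLpNorm'_le_eLpNorm'_of_exponent_le one_pos hq.le P hm.aestronglyMeasurable
  simp only [eLpNorm', enorm_eq_self, ENNReal.rpow_one, div_one] at h
  refine h.trans (le_of_eq ?_)
  congr 1
  rw [← lintegral_finsetSum (s := Finset.univ) (f := fun i ω => ENNReal.ofReal (|b i ω| ^ q))
    fun i _ => ((hb i).abs.pow_const q).ennreal_ofReal]
  refine lintegral_congr fun ω => ?_
  have he := ellNorm_rpow hq1 ENNReal.ofReal_ne_top fun i => b i ω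
  rw [ENNReal.toReal_ofReal hq0.le] at he
  rw [ENNReal.ofReal_rpow_of_nonneg (ellNorm_nonneg hq1 _) hq0.le, he,
    ENNReal.ofReal_sum_of_nonneg fun i _ => by positivity]

theorem ellNorm_integral_le {r : ℝ≥0∞} (hr : 1 ≤ r) {b : ι → Ω → ℝ}
    (hb : ∀ i, Integrable (b i) P) :
    ellNorm r (fun i => ∫ ω, b i ω ∂P) ≤ ∫ ω, ellNorm r (fun i => b i ω) ∂P := by
  have : Fact (1 ≤ r) := ⟨hr⟩
  have h := norm_integral_le_integral_norm (μ := P)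
    fun ω => (WithLp.toLp r fun i => b i ω : PiLp r fun _ : ι => ℝ)
  refine le_trans (le_of_eq ?_) h
  rw [ellNorm]
  congr 1
  ext i
  rw [eval_integral_piLp]
  exact hb

theorem integrable_of_lintegral_ofReal_lt_top {f : Ω → ℝ} (hf : AEMeasurable f P)
    (h0 : ∀ ω, 0 ≤ f ω) (h : ∫⁻ ω, ENNReal.ofReal (f ω) ∂P < ∞) : Integrable f P :=
  ⟨hf.aestronglyMeasurable, (hasFiniteIntegral_iff_ofReal (ae_of_all _ h0)).2 h⟩

end Mixed

/-! ### Assembling the rows, then the double expectation. -/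

section Main

variable {n : ℕ} {p : ℝ≥0∞} {q C : ℝ} {μ : Measure ℝ} [IsProbabilityMeasure μ]

theorem lintegral_rows_le (hq : 1 < q) (hqp : ENNReal.ofReal q < p) (hC : 0 < C)
    (hμ : Integrable id μ) (hμq : Integrable (fun x => |x| ^ q) μ)
    (hI : IntegralCondition (orliczFun μ id p) q C) (a : Fin n → Fin n → ℝ) :
    ∫⁻ x, ENNReal.ofReal (ellNorm (ENNReal.ofReal q) fun i => ellNorm p fun j => a i j * x j)
      ∂(Measure.pi fun _ : Fin n => μ) ≤
      ENNReal.ofReal (rowUpperConst p q C ^ (1 / q) * ellNorm (ENNReal.ofReal q)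
        fun i => luxemburgNorm (orliczFun μ id p) (a i)) := by
  have hp := one_lt_of_ofReal_lt hq hqp
  have hq1 : 1 ≤ ENNReal.ofReal q := by simpa using hq.le
  have hK := rowUpperConst_pos (q := q) hp hC
  have hN := fun i => luxemburgNorm_nonneg (orliczFun μ id p) (a i)
  refine (lintegral_ofReal_ellNorm_le hq fun i =>
    (measurable_ellNorm hp.le).comp (by fun_prop)).trans ?_
  have hrow : ∀ i, ∫⁻ x, ENNReal.ofReal (|(ellNorm p ∘ fun x j => a i j * x j) x| ^ q)
      ∂(Measure.pi fun _ : Fin n => μ) ≤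
      ENNReal.ofReal (luxemburgNorm (orliczFun μ id p) (a i) ^ q * rowUpperConst p q C) :=
    fun i => by
      simp only [Function.comp, abs_of_nonneg (ellNorm_nonneg hp.le _)]
      exact lintegral_row_rpow_le hq hqp hC hμ hμq hI (a i)
  refine (ENNReal.rpow_le_rpow (Finset.sum_le_sum fun i _ => hrow i) (by positivity)).trans
    (le_of_eq ?_)
  have hterm : ∀ i, 0 ≤ luxemburgNorm (orliczFun μ id p) (a i) ^ q * rowUpperConst p q C :=
    fun i => mul_nonneg (Real.rpow_nonneg (hN i) _) hK.le
  rw [← ENNReal.ofReal_sum_of_nonneg fun i _ => hterm i,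
    ENNReal.ofReal_rpow_of_nonneg (Finset.sum_nonneg fun i _ => hterm i) (by positivity),
    ← Finset.sum_mul, Real.mul_rpow (Finset.sum_nonneg fun i _ => Real.rpow_nonneg (hN i) _) hK.le,
    mul_comm, ellNorm_eq_sum hq1 ENNReal.ofReal_ne_top, ENNReal.toReal_ofReal (by linarith)]
  simp only [abs_of_nonneg (hN _)]

/-- The finiteness assumption makes the row norms Bochner integrable, so that the norm of the
integral is bounded by the integral of the norm. -/
theorem le_lintegral_rows (hq : 1 < q) (hqp : ENNReal.ofReal q < p)
    (hμ : Integrable id μ) (a : Fin n → Fin n → ℝ)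
    (hfin : ∫⁻ x, ENNReal.ofReal (ellNorm (ENNReal.ofReal q) fun i => ellNorm p
      fun j => a i j * x j) ∂(Measure.pi fun _ : Fin n => μ) < ∞) :
    ENNReal.ofReal (ellLowerConst (conjFactor p) * ellNorm (ENNReal.ofReal q)
        fun i => luxemburgNorm (orliczFun μ id p) (a i)) ≤
      ∫⁻ x, ENNReal.ofReal (ellNorm (ENNReal.ofReal q) fun i => ellNorm p fun j => a i j * x j)
        ∂(Measure.pi fun _ : Fin n => μ) := by
  have hp := one_lt_of_ofReal_lt hq hqp
  have hq1 : 1 ≤ ENNReal.ofReal q := by simpa using hq.le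
  have hc := ellLowerConst_pos (conjFactor_pos hp)
  have hN := fun i => luxemburgNorm_nonneg (orliczFun μ id p) (a i)
  have hbm : ∀ i, Measurable fun x : Fin n → ℝ => ellNorm p fun j => a i j * x j := fun i =>
    (measurable_ellNorm hp.le).comp (by fun_prop)
  have hint := integrable_of_lintegral_ofReal_lt_top
    ((measurable_ellNorm hq1).comp (measurable_pi_lambda _ hbm)).aemeasurable
    (fun x => ellNorm_nonneg hq1 _) hfin
  have hbint : ∀ i, Integrable (fun x : Fin n → ℝ => ellNorm p fun j => a i j * x j)
      (Measure.pi fun _ : Fin n => μ) := fun i =>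
    hint.mono' (hbm i).aestronglyMeasurable (ae_of_all _ fun x =>
      abs_le_ellNorm hq1 (fun i => ellNorm p fun j => a i j * x j) i)
  have hβ : ∀ i, luxemburgNorm (orliczFun μ id p) (a i) * ellLowerConst (conjFactor p) ≤
      ∫ x, ellNorm p (fun j => a i j * x j) ∂(Measure.pi fun _ : Fin n => μ) := fun i => by
    rw [← ENNReal.ofReal_le_ofReal_iff (integral_nonneg fun x => ellNorm_nonneg hp.le _),
      ofReal_integral_eq_lintegral_ofReal (hbint i) (ae_of_all _ fun x => ellNorm_nonneg hp.le _)]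
    exact le_lintegral_row hp hμ (a i)
  have hmono : ellLowerConst (conjFactor p) * ellNorm (ENNReal.ofReal q)
      (fun i => luxemburgNorm (orliczFun μ id p) (a i)) ≤ ellNorm (ENNReal.ofReal q)
      fun i => ∫ x, ellNorm p (fun j => a i j * x j) ∂(Measure.pi fun _ : Fin n => μ) := by
    conv_lhs => rw [← abs_of_pos hc, ← ellNorm_smul hq1]
    refine ellNorm_mono hq1 fun i => ?_
    rw [mul_comm, abs_of_nonneg (mul_nonneg (hN i) hc.le)]
    exact (hβ i).trans (le_abs_self _)
  refine (ENNReal.ofReal_le_ofReal (hmono.trans (ellNorm_integral_le hq1 hbint))).trans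
    (le_of_eq ?_)
  exact ofReal_integral_eq_lintegral_ofReal hint (ae_of_all _ fun x => ellNorm_nonneg hq1 _)

theorem measurable_ellNorm_matrix (hp : 1 ≤ p) (a : Fin n → Fin n → ℝ) :
    Measurable fun z : (Fin n → ℝ) × (Fin n → ℝ) =>
      ellNorm p fun k : Fin n × Fin n => a k.1 k.2 * z.1 k.1 * z.2 k.2 :=
  (measurable_ellNorm hp).comp (by fun_prop)

theorem lintegral_matrix_le (hq : 1 < q) (hqp : ENNReal.ofReal q < p)
    (a : Fin n → Fin n → ℝ) :
    ∫⁻ z, ENNReal.ofReal (ellNorm p fun k : Fin n × Fin n => a k.1 k.2 * z.1 k.1 * z.2 k.2)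
      ∂((Measure.pi fun _ : Fin n => paretoTypeLaw q).prod (Measure.pi fun _ : Fin n => μ)) ≤
      ENNReal.ofReal (paretoUpperConst p q) * ∫⁻ x, ENNReal.ofReal (ellNorm (ENNReal.ofReal q)
        fun i => ellNorm p fun j => a i j * x j) ∂(Measure.pi fun _ : Fin n => μ) := by
  have := isProbabilityMeasure_paretoTypeLaw hq
  have hp := one_lt_of_ofReal_lt hq hqp
  have hK : 0 ≤ paretoUpperConst p q := by
    have := paretoSmallConst_nonneg hq hqp
    unfold paretoUpperConst
    positivity
  -- The Pareto variables are integrated in the inner integral, with the row norms as fixed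
  -- coefficients.
  rw [lintegral_prod_symm _ (measurable_ellNorm_matrix hp.le a).ennreal_ofReal.aemeasurable,
    ← lintegral_const_mul' _ _ ENNReal.ofReal_ne_top]
  refine lintegral_mono fun x => ?_
  simp only [ellNorm_mul_mul hp.le, ← ENNReal.ofReal_mul hK]
  exact lintegral_pareto_ellNorm_le hq hqp _

theorem le_lintegral_matrix (hq : 1 < q) (hp : 1 ≤ p) (a : Fin n → Fin n → ℝ) :
    ENNReal.ofReal ((q - 1) ^ (1 / q) / 2) * ∫⁻ x, ENNReal.ofReal (ellNorm (ENNReal.ofReal q)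
        fun i => ellNorm p fun j => a i j * x j) ∂(Measure.pi fun _ : Fin n => μ) ≤
      ∫⁻ z, ENNReal.ofReal (ellNorm p fun k : Fin n × Fin n => a k.1 k.2 * z.1 k.1 * z.2 k.2)
        ∂((Measure.pi fun _ : Fin n => paretoTypeLaw q).prod (Measure.pi fun _ : Fin n => μ)) := by
  have := isProbabilityMeasure_paretoTypeLaw hq
  have hκ := paretoThreshold_pos hq
  rw [lintegral_prod_symm _ (measurable_ellNorm_matrix hp a).ennreal_ofReal.aemeasurable,
    ← lintegral_const_mul' _ _ ENNReal.ofReal_ne_top]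
  refine lintegral_mono fun x => ?_
  simp only [ellNorm_mul_mul hp, ← ENNReal.ofReal_mul (half_pos hκ).le]
  exact le_lintegral_pareto_ellNorm hq hp _

theorem hasLaw_prod_of_iIndepFun {Ω : Type*} [MeasurableSpace Ω] {P : Measure Ω}
    [IsProbabilityMeasure P] {ν : Measure ℝ} [IsProbabilityMeasure ν] {ξ X : Fin n → Ω → ℝ}
    (hξ : ∀ i, HasLaw (ξ i) ν P) (hX : ∀ j, HasLaw (X j) μ P) (hind : iIndepFun (Sum.elim ξ X) P) :
    HasLaw (fun ω => ((fun i => ξ i ω), fun j => X j ω))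
      ((Measure.pi fun _ : Fin n => ν).prod (Measure.pi fun _ : Fin n => μ)) P := by
  let ρ : Fin n ⊕ Fin n → Measure ℝ := Sum.elim (fun _ => ν) fun _ => μ
  have hρ : ∀ k, IsProbabilityMeasure (ρ k) := by
    rintro (k | k)
    exacts [inferInstanceAs (IsProbabilityMeasure ν), inferInstanceAs (IsProbabilityMeasure μ)]
  have hlaw : ∀ k, HasLaw (Sum.elim ξ X k) (ρ k) P := by
    rintro (k | k)
    exacts [hξ k, hX k]
  have h1 := hind.hasLaw_pi hlaw
  have h2 := measurePreserving_sumPiEquivProdPi (X := fun _ : Fin n ⊕ Fin n => ℝ) ρ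
  have h3 : HasLaw _ _ (Measure.pi ρ) := ⟨h2.measurable.aemeasurable, h2.map_eq⟩
  exact h3.comp h1

end Main

theorem theorem1p2 (q : ℝ) (p : ℝ≥0∞) (hq : 1 < q) (hqp : ENNReal.ofReal q < p) :
    ∃ c₁ : ℝ, 0 < c₁ ∧ ∀ C : ℝ, 0 < C → ∃ c₂ : ℝ, 0 < c₂ ∧
      ∀ (Ω₀ : Type*) [MeasurableSpace Ω₀] (P₀ : Measure Ω₀) [IsProbabilityMeasure P₀]
        (X₀ : Ω₀ → ℝ),
        MemLp X₀ (ENNReal.ofReal q) P₀ →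
        AbsHasContinuousDensity P₀ X₀ →
        LimitCondition (orliczFun P₀ X₀ p) q →
        IntegralCondition (orliczFun P₀ X₀ p) q C →
        ∀ (n : ℕ) (Ω : Type*) [MeasurableSpace Ω] (P : Measure Ω) [IsProbabilityMeasure P]
          (ξ X : Fin n → Ω → ℝ),
          (∀ i, HasLaw (ξ i) (paretoTypeLaw q) P) →
          (∀ j, IdentDistrib (X j) X₀ P P₀) →
          iIndepFun (Sum.elim ξ X) P →
          ∀ a : Fin n → Fin n → ℝ,
            Integrable
              (fun ω => ellNorm p fun k : Fin n × Fin n => a k.1 k.2 * ξ k.1 ω * X k.2 ω) P ∧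
            c₁ * ellNorm (ENNReal.ofReal q)
                (fun i => luxemburgNorm (orliczFun P₀ X₀ p) (a i))
              ≤ ∫ ω, ellNorm p (fun k : Fin n × Fin n => a k.1 k.2 * ξ k.1 ω * X k.2 ω) ∂P ∧
            ∫ ω, ellNorm p (fun k : Fin n × Fin n => a k.1 k.2 * ξ k.1 ω * X k.2 ω) ∂P
              ≤ c₂ * ellNorm (ENNReal.ofReal q)
                (fun i => luxemburgNorm (orliczFun P₀ X₀ p) (a i)) := by
  have hp := one_lt_of_ofReal_lt hq hqp
  have hκ := paretoThreshold_pos hq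
  have hκ2 : 0 ≤ (q - 1) ^ (1 / q) / 2 := by positivity
  have hL := ellLowerConst_pos (conjFactor_pos hp)
  have hq1 : 1 ≤ ENNReal.ofReal q := by simpa using hq.le
  have hK : 0 < paretoUpperConst p q := by
    have := paretoSmallConst_nonneg hq hqp
    unfold paretoUpperConst
    positivity
  refine ⟨(q - 1) ^ (1 / q) / 2 * ellLowerConst (conjFactor p), by positivity, fun C hC => ?_⟩
  have hR := rowUpperConst_pos (q := q) hp hC
  refine ⟨paretoUpperConst p q * rowUpperConst p q C ^ (1 / q), by positivity, ?_⟩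
  intro Ω₀ _ P₀ _ X₀ hX₀ _ _ hI n Ω _ P _ ξ X hξ hX hind a
  have hX₀m := hX₀.aestronglyMeasurable.aemeasurable
  have hμP : IsProbabilityMeasure (P₀.map X₀) := Measure.isProbabilityMeasure_map hX₀m
  have hνP := isProbabilityMeasure_paretoTypeLaw hq
  rw [orliczFun_eq_map hX₀m] at hI ⊢
  have hmem : MemLp id (ENNReal.ofReal q) (P₀.map X₀) :=
    (memLp_map_measure_iff aestronglyMeasurable_id hX₀m).2 hX₀
  have hμ : Integrable id (P₀.map X₀) := hmem.integrable hq1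
  have hμq : Integrable (fun x => |x| ^ q) (P₀.map X₀) := by
    have := hmem.integrable_norm_rpow (by simpa using zero_lt_one.trans hq) ENNReal.ofReal_ne_top
    simpa [ENNReal.toReal_ofReal (zero_lt_one.trans hq).le] using this
  have hlaw := hasLaw_prod_of_iIndepFun hξ
    (fun j => ⟨(hX j).aemeasurable_fst, (hX j).map_eq⟩) hind
  have hFm := measurable_ellNorm_matrix hp.le a
  have hE := hlaw.lintegral_comp hFm.ennreal_ofReal.aemeasurable
  have hup := lintegral_rows_le hq hqp hC hμ hμq hI a
  -- The upper bound comes first because it supplies the finiteness that the lower bound needs.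
  have hlow := le_lintegral_rows hq hqp hμ a (hup.trans_lt ENNReal.ofReal_lt_top)
  have hup' := (lintegral_matrix_le hq hqp a).trans (mul_le_mul_right hup _)
  have hlow' := (mul_le_mul_right hlow _).trans (le_lintegral_matrix hq hp.le a)
  rw [← hE, ← ENNReal.ofReal_mul hK.le, ← mul_assoc] at hup'
  rw [← hE, ← ENNReal.ofReal_mul hκ2, ← mul_assoc] at hlow'
  have h0 : ∀ ω, 0 ≤ ellNorm p fun k : Fin n × Fin n => a k.1 k.2 * ξ k.1 ω * X k.2 ω :=
    fun ω => ellNorm_nonneg hp.le _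
  have hint := integrable_of_lintegral_ofReal_lt_top (hFm.comp_aemeasurable hlaw.aemeasurable) h0
    (hup'.trans_lt ENNReal.ofReal_lt_top)
  have hEr := ofReal_integral_eq_lintegral_ofReal hint (ae_of_all _ h0)
  refine ⟨hint, ?_, ?_⟩
  · rw [← ENNReal.ofReal_le_ofReal_iff (integral_nonneg h0)]
    exact hlow'.trans hEr.ge
  · rw [← ENNReal.ofReal_le_ofReal_iff (mul_nonneg (by positivity) (ellNorm_nonneg hq1 _))]
    exact hEr.le.trans hup'
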